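/- For $\lambda>0$ define $$g(\lambda)=\begin{cases}\dfrac{\lambda}{(1-\lambda^2)^{3/2}}\left(\log\dfrac{1+\sqrt{1-\lambda^2}}{\lambda}-\sqrt{1-\lambda^2}\right), & 0<\lambda<1,\\[2mm] \dfrac13, & \lambda=1,\\[2mm] \dfrac{\lambda}{(\lambda^2-1)^{3/2}}\left(\sqrt{\lambda^2-1}-\sec^{-1}\lambda\right), & \lambda>1,\end{cases}$$ where $\sec^{-1}\lambda=\arccos(1/\lambda)$. The maximum $L^*=\max_{\lambda>0}g(\lambda)$ exists. For $L>0$ and $\lambda>0$, a solution is a function $u\in C^2(-L,L)\cap C[-L,L]$ with $u<1$ on $[-L,L]$, $u(-L)=u(L)=0$ and $$-\left(\frac{u'}{\sqrt{1+(u')^2}}\right)'=\frac{\lambda}{(1-u)^2}\quad\text{on }(-L,L);$$ it is positive if $u>0$ on $(-L,L)$. Let $L>0$. (i) If $L<L^*$, there are $0<\lambda_*<\lambda_{**}<\lambda^*$, depending on $L$, such that the problem has exactly two positive solutions for every $\lambda\in(0,\lambda_*]\cup[\lambda_{**},\lambda^*)$, exactly one positive solution for every $\lambda\in(\lambda_*,\lambda_{**})\cup\{\lambda^*\}$,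 and no solutions for every $\lambda>\lambda^*$. (ii) If $L\ge L^*$, there is $\lambda^*>0$, depending on $L$, such that the problem has exactly two positive solutions for every $\lambda\in(0,\lambda^*)$, exactly one positive solution for $\lambda=\lambda^*$, and no solutions for every $\lambda>\lambda^*$. In both cases, $\lambda^*<\min\{L^{-1},\ \pi^2/(27L^2)\}$. -/

import Mathlib

/-- The function `g` on `(0, ∞)`. For `l > 1` the inverse secant `sec⁻¹ l ∈ (0, π/2)` is
`Real.arccos (1 / l)`. (Only values at `l > 0` are used.) -/
noncomputable def gFun (l : ℝ) : ℝ :=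
  if l < 1 then
    l / (1 - l ^ 2) ^ (3 / 2 : ℝ)
      * (Real.log ((1 + Real.sqrt (1 - l ^ 2)) / l) - Real.sqrt (1 - l ^ 2))
  else if l = 1 then 1 / 3
  else
    l / (l ^ 2 - 1) ^ (3 / 2 : ℝ) * (Real.sqrt (l ^ 2 - 1) - Real.arccos (1 / l))

/-- `u` is a classical solution, of class `C²(-L,L) ∩ C[-L,L]`, of
`-(u' / √(1 + u'²))' = lam / (1 - u)²` on `(-L, L)` with `u(-L) = u(L) = 0` and `u < 1` on
`[-L, L]`. No differentiability is required at `x = -L` and `x = L`. -/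
structure IsClassicalSolution (lam L : ℝ) (u : ℝ → ℝ) : Prop where
  contDiffOn : ContDiffOn ℝ 2 u (Set.Ioo (-L) L)
  continuousOn : ContinuousOn u (Set.Icc (-L) L)
  lt_one : ∀ x ∈ Set.Icc (-L) L, u x < 1
  left_boundary : u (-L) = 0
  right_boundary : u L = 0
  equation : ∀ x ∈ Set.Ioo (-L) L,
    -deriv (fun y => deriv u y / Real.sqrt (1 + deriv u y ^ 2)) x = lam / (1 - u x) ^ 2

/-- The set of positive classical solutions, as functions on `[-L, L]` (restricting to `[-L, L]`
identifies functions on `ℝ` that differ only outside this interval). -/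
def positiveSolutions (lam L : ℝ) : Set (Set.Icc (-L) L → ℝ) :=
  (fun (u : ℝ → ℝ) (x : Set.Icc (-L) L) => u x) ''
    {u | IsClassicalSolution lam L u ∧ ∀ x ∈ Set.Ioo (-L) L, 0 < u x}

/-! The proof is a time-map argument. Put `lam = μ²` and let `θ` be the inclination angle of the
graph of `u`. The equation has the first integral `cos θ - μ² / (1 - u) = const`. If the maximum of
`u` is `1 - 1 / (1 + ρ²)` and `s` is defined by `1 / (1 - u) = 1 + ρ² - s²`, this becomes `cos θ = 1
- (μ s)²`, so `μ s` is `√2 sin (θ / 2)` up to sign. Integrating `dx/ds` gives `profileX`, and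
solutions correspond exactly to the roots `ρ ∈ (0, 1/μ]` of `timeMap μ ρ = L`
(`encard_positiveSolutions`). The endpoint `ρ = 1/μ` is a profile with vertical slope at `±L`; it is
admissible because no derivative is required there.

The count rests on four facts. (a) `timeMap μ` vanishes at `0`, increases strictly to a peak in `(0,
1/μ)`, then decreases strictly (`exists_timeMap_peak`). It is strictly concave for `ρ ≤ min 1
(1/μ)`, strictly decreasing for `ρ ≥ 1`, and not maximal at `1/μ`. (b) For fixed `ρ` it decreases
strictly in `μ`. Hence there is one critical `μ` whose peak equals `L`, with higher peaks below it
and lower ones above it (`exists_critical_parameter`). (c) Its value at the endpoint `1/μ` is `gFun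
(μ²)` (`gFun_sq`). Below the critical parameter there are therefore two roots if `gFun lam ≤ L`, and
one if `L < gFun lam`. (d) `gFun` tends to `0` at `0` and at infinity and is strictly quasiconcave
(`min_lt_gFun`), since it is strictly concave in `(1 - l) / (1 + l)`. So `{gFun > L}` is an open
interval, empty once `L` reaches the maximum.

The bounds on the critical parameter are `μ² T < 1` and `μ² T² < π² / 27` for every value `T` of the
time map; the second comes from comparison with the linear problem with right-hand side `27 lam u /
4`. -/

/-! ### The weight, the profile abscissa and the time map. -/

/-- The profile weight `(1 - x²) / √(2 - x²)` on `[-1, 1]`, extended continuously to `ℝ`. -/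
noncomputable def angleWeight (x : ℝ) : ℝ := (1 - x ^ 2) / Real.sqrt (1 + |1 - x ^ 2|)

theorem continuous_angleWeight : Continuous angleWeight := by
  unfold angleWeight
  refine Continuous.div (by fun_prop) (by fun_prop) fun x => ?_
  have : 0 < 1 + |1 - x ^ 2| := by positivity
  positivity

theorem angleWeight_eq {x : ℝ} (h : x ^ 2 ≤ 1) :
    angleWeight x = (1 - x ^ 2) / Real.sqrt (2 - x ^ 2) := by
  rw [angleWeight, abs_of_nonneg (by linarith)]
  congr 2; ring

theorem angleWeight_neg (x : ℝ) : angleWeight (-x) = angleWeight x := by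
  simp [angleWeight]

theorem angleWeight_one : angleWeight 1 = 0 := by simp [angleWeight]

theorem angleWeight_zero : angleWeight 0 = 1 / Real.sqrt 2 := by
  rw [angleWeight_eq (by norm_num)]; norm_num

theorem angleWeight_pos {x : ℝ} (h : x ^ 2 < 1) : 0 < angleWeight x := by
  rw [angleWeight]
  have : 0 < 1 + |1 - x ^ 2| := by positivity
  exact div_pos (by linarith) (Real.sqrt_pos.2 this)

theorem angleWeight_nonneg {x : ℝ} (h : x ^ 2 ≤ 1) : 0 ≤ angleWeight x := by
  rw [angleWeight]
  exact div_nonneg (by linarith) (Real.sqrt_nonneg _)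

/-- With `p = √(2 - x²)` the weight is `p - 1 / p`, which increases with `p`. -/
theorem strictAntiOn_angleWeight : StrictAntiOn angleWeight (Set.Icc 0 1) := by
  have key : ∀ x ∈ Set.Icc (0 : ℝ) 1,
      angleWeight x = Real.sqrt (2 - x ^ 2) - 1 / Real.sqrt (2 - x ^ 2) := by
    rintro x ⟨h0, h1⟩
    have hx : x ^ 2 ≤ 1 := by nlinarith
    have hp : 0 < Real.sqrt (2 - x ^ 2) := Real.sqrt_pos.2 (by linarith)
    rw [angleWeight_eq hx]
    field_simp
    rw [Real.sq_sqrt (by linarith)]; ring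
  intro x hx y hy hxy
  rw [key x hx, key y hy]
  have hy1 : y ^ 2 ≤ 1 := by nlinarith [hy.1, hy.2]
  have hlt : Real.sqrt (2 - y ^ 2) < Real.sqrt (2 - x ^ 2) :=
    Real.sqrt_lt_sqrt (by linarith) (by nlinarith [hx.1])
  have hp : 0 < Real.sqrt (2 - y ^ 2) := Real.sqrt_pos.2 (by linarith)
  have := one_div_lt_one_div_of_lt hp hlt
  linarith

theorem angleWeight_le_of_le {x y : ℝ} (hx : 0 ≤ x) (hxy : x ≤ y) (hy : y ≤ 1) :
    angleWeight y ≤ angleWeight x :=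
  strictAntiOn_angleWeight.antitoneOn ⟨hx, hxy.trans hy⟩ ⟨hx.trans hxy, hy⟩ hxy

/-- For `x = √2 sin (θ / 2)` the primitive `x √(2 - x²)` is `sin θ`, up to sign the flux `u' / √(1 +
u'²)`. -/
theorem hasDerivAt_mul_sqrt {x : ℝ} (h : x ^ 2 < 2) (h1 : x ^ 2 ≤ 1) :
    HasDerivAt (fun x : ℝ => x * Real.sqrt (2 - x ^ 2)) (2 * angleWeight x) x := by
  have hp : 0 < Real.sqrt (2 - x ^ 2) := Real.sqrt_pos.2 (by linarith)
  have hd : HasDerivAt (fun x : ℝ => 2 - x ^ 2) (-(2 * x)) x := by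
    simpa using (hasDerivAt_pow 2 x).const_sub 2
  have := (hasDerivAt_id x).mul (hd.sqrt (by linarith))
  refine this.congr_deriv ?_
  rw [angleWeight_eq h1]
  simp only [id]
  field_simp
  rw [Real.sq_sqrt (by linarith)]; ring

/-- The abscissa of the solution profile with parameter `ρ`, as a function of the
variable `s` for which the profile height is `1 - 1 / (1 + ρ² - s²)`; here `lam = μ²`. -/
noncomputable def profileX (μ ρ s : ℝ) : ℝ :=
  2 / μ * ∫ t in (0 : ℝ)..s, angleWeight (μ * t) / (1 + |ρ ^ 2 - t ^ 2|) ^ 2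

/-- The time map: half the length of the interval on which the profile with parameter `ρ` lives. -/
noncomputable def timeMap (μ ρ : ℝ) : ℝ := profileX μ ρ ρ

/-- The integrand of the time map, rescaled to `[0, 1]`. -/
noncomputable def timeKernel (μ ρ z : ℝ) : ℝ :=
  ρ * angleWeight (μ * ρ * z) / (1 + ρ ^ 2 * |1 - z ^ 2|) ^ 2

theorem continuous_profile_integrand (μ ρ : ℝ) :
    Continuous fun t : ℝ => angleWeight (μ * t) / (1 + |ρ ^ 2 - t ^ 2|) ^ 2 := by
  refine Continuous.div (continuous_angleWeight.comp (by fun_prop)) (by fun_prop) fun x => ?_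
  positivity

theorem continuous_timeKernel :
    Continuous fun p : ℝ × ℝ × ℝ => timeKernel p.1 p.2.1 p.2.2 := by
  unfold timeKernel
  refine Continuous.div (Continuous.mul (by fun_prop)
    (continuous_angleWeight.comp (by fun_prop))) (by fun_prop) fun x => ?_
  positivity

theorem continuous_timeKernel_right (μ ρ : ℝ) : Continuous fun z => timeKernel μ ρ z :=
  continuous_timeKernel.comp (by fun_prop : Continuous fun z : ℝ => (μ, ρ, z))

theorem timeMap_eq_integral (μ ρ : ℝ) :
    timeMap μ ρ = 2 / μ * ∫ z in (0 : ℝ)..1, timeKernel μ ρ z := by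
  rw [timeMap, profileX]
  congr 1
  have := intervalIntegral.mul_integral_comp_mul_left (a := 0) (b := 1)
    (f := fun t : ℝ => angleWeight (μ * t) / (1 + |ρ ^ 2 - t ^ 2|) ^ 2) (c := ρ)
  rw [mul_zero, mul_one] at this
  rw [← this, ← intervalIntegral.integral_const_mul]
  refine intervalIntegral.integral_congr fun z _ => ?_
  have : |ρ ^ 2 - (ρ * z) ^ 2| = ρ ^ 2 * |1 - z ^ 2| := by
    rw [show ρ ^ 2 - (ρ * z) ^ 2 = ρ ^ 2 * (1 - z ^ 2) by ring, abs_mul, abs_of_nonneg (sq_nonneg ρ)]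
  simp only [timeKernel, this]
  ring_nf

theorem continuous_integral_timeKernel :
    Continuous fun p : ℝ × ℝ => ∫ z in (0 : ℝ)..1, timeKernel p.1 p.2 z := by
  refine intervalIntegral.continuous_parametric_intervalIntegral_of_continuous' ?_ 0 1
  exact continuous_timeKernel.comp
    (by fun_prop : Continuous fun q : (ℝ × ℝ) × ℝ => (q.1.1, q.1.2, q.2))

theorem continuousOn_timeMap :
    ContinuousOn (fun p : ℝ × ℝ => timeMap p.1 p.2) {p | 0 < p.1} := by
  simp only [timeMap_eq_integral]
  refine ContinuousOn.mul ?_ continuous_integral_timeKernel.continuousOn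
  exact ContinuousOn.div continuousOn_const continuousOn_fst fun p hp => ne_of_gt hp

theorem continuous_timeMap_right (μ : ℝ) : Continuous (timeMap μ) := by
  have : timeMap μ = fun ρ => 2 / μ * ∫ z in (0 : ℝ)..1, timeKernel μ ρ z :=
    funext (timeMap_eq_integral μ)
  rw [this]
  exact continuous_const.mul (continuous_integral_timeKernel.comp
    (by fun_prop : Continuous fun ρ : ℝ => (μ, ρ)))

theorem timeMap_zero (μ : ℝ) : timeMap μ 0 = 0 := by simp [timeMap, profileX]

theorem hasDerivAt_profileX (μ ρ s : ℝ) : HasDerivAt (profileX μ ρ)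
    (2 / μ * (angleWeight (μ * s) / (1 + |ρ ^ 2 - s ^ 2|) ^ 2)) s := by
  have h := continuous_profile_integrand μ ρ
  exact (intervalIntegral.integral_hasDerivAt_right (h.intervalIntegrable _ _)
    (h.stronglyMeasurableAtFilter _ _) h.continuousAt).const_mul (2 / μ)

theorem profileX_neg (μ ρ s : ℝ) : profileX μ ρ (-s) = -profileX μ ρ s := by
  have := intervalIntegral.integral_comp_neg (a := 0) (b := s)
    (f := fun t : ℝ => angleWeight (μ * t) / (1 + |ρ ^ 2 - t ^ 2|) ^ 2)
  simp only [mul_neg, angleWeight_neg, neg_sq, neg_zero] at this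
  rw [profileX, profileX, this, intervalIntegral.integral_symm (-s) 0]
  ring

theorem strictMonoOn_profileX {μ ρ : ℝ} (hμ : 0 < μ) (hρ : μ * ρ ≤ 1) :
    StrictMonoOn (profileX μ ρ) (Set.Icc (-ρ) ρ) := by
  refine strictMonoOn_of_deriv_pos (convex_Icc _ _)
    (fun s _ => (hasDerivAt_profileX μ ρ s).continuousAt.continuousWithinAt) fun s hs => ?_
  rw [interior_Icc] at hs
  rw [(hasDerivAt_profileX μ ρ s).deriv]
  have : (μ * s) ^ 2 < 1 := by
    rw [sq_lt_one_iff_abs_lt_one, abs_mul, abs_of_pos hμ]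
    have : |s| < ρ := abs_lt.2 hs
    nlinarith
  have := angleWeight_pos this
  positivity

/-! ### Strict concavity of the time map for `ρ ≤ 1`. -/

/-- Homogenize to degree 5 with `r + y + v = 1`. Minus the left side is then `5 y` plus a polynomial
in `r`, `y`, `v` with nonnegative coefficients. -/
theorem kernel_concavity_polynomial {y v : ℝ} (hy : 0 < y) (hv : 0 ≤ v) (h : y + v ≤ 1) :
    2 * ((-3 * y + 2 * y ^ 2 - v * (3 - 3 * y + y ^ 2) - v * (-3 * y + 2 * y ^ 2))
      * (1 + v) * (2 - y)) - 6 * v * (2 - y) * (1 - 3 * y + y ^ 2 - v * (3 - 3 * y + y ^ 2))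
      + 3 * y * (1 + v) * (1 - 3 * y + y ^ 2 - v * (3 - 3 * y + y ^ 2)) < 0 := by
  obtain ⟨r, hr⟩ : ∃ r, r = 1 - y - v := ⟨_, rfl⟩
  have hr0 : 0 ≤ r := by linarith
  have hpos : 0 ≤ 24 * v * r ^ 4 + 72 * v ^ 2 * r ^ 3 + 72 * v ^ 3 * r ^ 2 + 24 * v ^ 4 * r
      + y * (4 * r ^ 4 + 58 * v * r ^ 3 + 111 * v ^ 2 * r ^ 2 + 64 * v ^ 3 * r + 7 * v ^ 4)
      + y ^ 2 * (11 * r ^ 3 + 55 * v * r ^ 2 + 56 * v ^ 2 * r + 12 * v ^ 3)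
      + y ^ 3 * (10 * r ^ 2 + 26 * v * r + 13 * v ^ 2) + y ^ 4 * (3 * r + 5 * v) := by
    positivity
  rw [hr] at hpos
  nlinarith [hpos]

/-- The derivative of the rescaled time-map integrand in `ρ`. -/
theorem hasDerivAt_kernel {c d x : ℝ} (hd : 0 ≤ d) (hx : (c * x) ^ 2 < 2) :
    HasDerivAt (fun x : ℝ => x * ((1 - (c * x) ^ 2) / Real.sqrt (2 - (c * x) ^ 2))
        / (1 + x ^ 2 * d) ^ 2)
      (2 * (1 - 3 * (c * x) ^ 2 + (c * x) ^ 4 - x ^ 2 * d * (3 - 3 * (c * x) ^ 2 + (c * x) ^ 4))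
        / ((1 + x ^ 2 * d) * Real.sqrt (2 - (c * x) ^ 2)) ^ 3) x := by
  have hw : 0 < Real.sqrt (2 - (c * x) ^ 2) := Real.sqrt_pos.2 (by linarith)
  have hv : 0 < 1 + x ^ 2 * d := by positivity
  have hy : HasDerivAt (fun x : ℝ => (c * x) ^ 2) (2 * c ^ 2 * x) x := by
    refine (((hasDerivAt_id x).const_mul c).pow 2).congr_deriv ?_
    simp; ring
  have h2 : HasDerivAt (fun x : ℝ => 1 + x ^ 2 * d) (2 * x * d) x := by
    refine (((hasDerivAt_pow 2 x).mul_const d).const_add 1).congr_deriv ?_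
    simp
  have := ((hasDerivAt_id x).mul ((hy.const_sub 1).div
    ((hy.const_sub 2).sqrt (by linarith)) hw.ne')).div (h2.pow 2) (ne_of_gt (pow_pos hv 2))
  refine this.congr_deriv ?_
  have hsq : Real.sqrt (2 - (c * x) ^ 2) ^ 2 = 2 - (c * x) ^ 2 := Real.sq_sqrt (by linarith)
  simp only [id, Pi.mul_apply, Pi.div_apply, Pi.pow_apply]
  set w := Real.sqrt (2 - (c * x) ^ 2) with hwdef
  have hc : (c * x) ^ 2 = 2 - w ^ 2 := by linarith
  have hc4 : (c * x) ^ 4 = (2 - w ^ 2) ^ 2 := by rw [← hc]; ring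
  rw [hc4, hc]
  rw [div_eq_div_iff (by positivity) (by positivity)]
  field_simp
  have : c ^ 2 * x ^ 2 = 2 - w ^ 2 := by rw [← hc]; ring
  linear_combination (-(1 + x ^ 2 * d) ^ 2 * (1 + w ^ 2)) * this

/-- The second derivative, arranged so that its only factor of unclear sign is the polynomial of
`kernel_concavity_polynomial` at `y = (c x)²`, `v = x² d`. -/
theorem hasDerivAt_kernel_deriv {c d x : ℝ} (hd : 0 ≤ d) (hx : (c * x) ^ 2 < 2) (hx0 : 0 < x) :
    HasDerivAt (fun x : ℝ => 2 * (1 - 3 * (c * x) ^ 2 + (c * x) ^ 4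
        - x ^ 2 * d * (3 - 3 * (c * x) ^ 2 + (c * x) ^ 4))
        / ((1 + x ^ 2 * d) * Real.sqrt (2 - (c * x) ^ 2)) ^ 3)
      (2 * (2 * ((-3 * (c * x) ^ 2 + 2 * ((c * x) ^ 2) ^ 2
          - x ^ 2 * d * (3 - 3 * (c * x) ^ 2 + ((c * x) ^ 2) ^ 2)
          - x ^ 2 * d * (-3 * (c * x) ^ 2 + 2 * ((c * x) ^ 2) ^ 2))
          * (1 + x ^ 2 * d) * (2 - (c * x) ^ 2))
        - 6 * (x ^ 2 * d) * (2 - (c * x) ^ 2) * (1 - 3 * (c * x) ^ 2 + ((c * x) ^ 2) ^ 2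
          - x ^ 2 * d * (3 - 3 * (c * x) ^ 2 + ((c * x) ^ 2) ^ 2))
        + 3 * (c * x) ^ 2 * (1 + x ^ 2 * d) * (1 - 3 * (c * x) ^ 2 + ((c * x) ^ 2) ^ 2
          - x ^ 2 * d * (3 - 3 * (c * x) ^ 2 + ((c * x) ^ 2) ^ 2)))
        / (x * (1 + x ^ 2 * d) ^ 4 * Real.sqrt (2 - (c * x) ^ 2) ^ 5)) x := by
  have hw : 0 < Real.sqrt (2 - (c * x) ^ 2) := Real.sqrt_pos.2 (by linarith)
  have hv : 0 < 1 + x ^ 2 * d := by positivity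
  have hy : HasDerivAt (fun x : ℝ => (c * x) ^ 2) (2 * (c * x) ^ 2 / x) x := by
    refine (((hasDerivAt_id x).const_mul c).pow 2).congr_deriv ?_
    simp; field_simp
  have hy4 : HasDerivAt (fun x : ℝ => (c * x) ^ 4) (4 * (c * x) ^ 4 / x) x := by
    refine (((hasDerivAt_id x).const_mul c).pow 4).congr_deriv ?_
    simp; field_simp
  have hxd : HasDerivAt (fun x : ℝ => x ^ 2 * d) (2 * (x ^ 2 * d) / x) x := by
    refine ((hasDerivAt_pow 2 x).mul_const d).congr_deriv ?_
    simp; field_simp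
  have hnum := ((((hy.const_mul 3).const_sub 1).add hy4).sub
    (hxd.mul (((hy.const_mul 3).const_sub 3).add hy4))).const_mul 2
  have hden := ((hxd.const_add 1).mul ((hy.const_sub 2).sqrt (by linarith))).pow 3
  have := hnum.div hden (ne_of_gt (pow_pos (mul_pos hv hw) 3))
  refine this.congr_deriv ?_
  have hsq : Real.sqrt (2 - (c * x) ^ 2) ^ 2 = 2 - (c * x) ^ 2 := Real.sq_sqrt (by linarith)
  simp only [Pi.mul_apply, Pi.pow_apply, Pi.add_apply, Pi.sub_apply]
  set w := Real.sqrt (2 - (c * x) ^ 2) with hwdef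
  have hc : (c * x) ^ 2 = 2 - w ^ 2 := by linarith
  have hc4 : (c * x) ^ 4 = (2 - w ^ 2) ^ 2 := by rw [← hc]; ring
  rw [hc4, hc]
  generalize x ^ 2 * d = v at hv ⊢
  field_simp
  ring

theorem strictConcaveOn_kernel {c d R : ℝ} (hc : 0 < c) (hd : 0 ≤ d)
    (hR : (c * R) ^ 2 + R ^ 2 * d ≤ 1) :
    StrictConcaveOn ℝ (Set.Icc 0 R) (fun x : ℝ =>
      x * ((1 - (c * x) ^ 2) / Real.sqrt (2 - (c * x) ^ 2)) / (1 + x ^ 2 * d) ^ 2) := by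
  have hsmall : ∀ x ∈ Set.Icc 0 R, (c * x) ^ 2 + x ^ 2 * d ≤ 1 := by
    rintro x ⟨h0, h1⟩
    refine le_trans ?_ hR
    have : x ^ 2 ≤ R ^ 2 := by gcongr
    rw [mul_pow, mul_pow]
    gcongr
  have hlt : ∀ x ∈ Set.Icc 0 R, (c * x) ^ 2 < 2 := fun x hx => by
    have := hsmall x hx
    have : 0 ≤ x ^ 2 * d := by positivity
    linarith
  refine StrictAntiOn.strictConcaveOn_of_deriv (convex_Icc _ _)
    (fun x hx => (hasDerivAt_kernel hd (hlt x hx)).continuousAt.continuousWithinAt) ?_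
  rw [interior_Icc]
  have hanti : StrictAntiOn (fun x : ℝ => 2 * (1 - 3 * (c * x) ^ 2 + (c * x) ^ 4
        - x ^ 2 * d * (3 - 3 * (c * x) ^ 2 + (c * x) ^ 4))
        / ((1 + x ^ 2 * d) * Real.sqrt (2 - (c * x) ^ 2)) ^ 3) (Set.Ioo 0 R) := by
    have hD := fun x (hx : x ∈ Set.Ioo 0 R) =>
      hasDerivAt_kernel_deriv hd (hlt x ⟨hx.1.le, hx.2.le⟩) hx.1
    refine strictAntiOn_of_deriv_neg (convex_Ioo _ _)
      (fun x hx => (hD x hx).continuousAt.continuousWithinAt) fun x hx => ?_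
    rw [interior_Ioo] at hx
    rw [(hD x hx).deriv]
    have hx0 := hx.1
    have hw : 0 < Real.sqrt (2 - (c * x) ^ 2) :=
      Real.sqrt_pos.2 (by linarith [hlt x ⟨hx.1.le, hx.2.le⟩])
    have hp := kernel_concavity_polynomial (y := (c * x) ^ 2) (v := x ^ 2 * d)
      (by positivity) (by positivity) (hsmall x ⟨hx.1.le, hx.2.le⟩)
    exact div_neg_of_neg_of_pos (mul_neg_of_pos_of_neg two_pos hp) (by positivity)
  refine hanti.congr fun x hx => ?_
  exact (hasDerivAt_kernel hd (hlt x ⟨hx.1.le, hx.2.le⟩)).deriv.symm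

/-- Here `c = μ z` and `d = 1 - z²`, so `(c R)² + R² d` is the convex combination of `(μ R)²` and
`R²` with weights `z²` and `1 - z²`; this is where both `μ R ≤ 1` and `R ≤ 1` enter. -/
theorem strictConcaveOn_timeKernel {μ R z : ℝ} (hμ : 0 < μ) (hR0 : 0 ≤ R) (hR : R ≤ 1)
    (hμR : μ * R ≤ 1) (hz : 0 < z) (hz1 : z ≤ 1) :
    StrictConcaveOn ℝ (Set.Icc 0 R) (fun ρ => timeKernel μ ρ z) := by
  have hzz : z ^ 2 ≤ 1 := by nlinarith
  have hR2 : R ^ 2 ≤ 1 := by nlinarith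
  have hμR2 : (μ * R) ^ 2 ≤ 1 := by have : 0 ≤ μ * R := by positivity
                                    nlinarith
  have := strictConcaveOn_kernel (c := μ * z) (d := 1 - z ^ 2) (R := R) (by positivity)
    (by linarith) (by nlinarith [mul_le_mul_of_nonneg_right hμR2 (sq_nonneg z),
      mul_le_mul_of_nonneg_right hR2 (sub_nonneg.2 hzz)])
  refine this.congr fun x hx => ?_
  have hle : (μ * z * x) ^ 2 ≤ 1 := by
    have h1 : μ * z * x ≤ μ * R := by
      calc μ * z * x = μ * (z * x) := by ring
        _ ≤ μ * R := by
          gcongr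
          nlinarith [hx.1, hx.2]
    have h2 : 0 ≤ μ * z * x := mul_nonneg (by positivity) hx.1
    nlinarith
  have : μ * x * z = μ * z * x := by ring
  simp only [timeKernel, this]
  rw [angleWeight_eq hle, abs_of_nonneg (by linarith)]

theorem strictConcaveOn_timeMap {μ R : ℝ} (hμ : 0 < μ) (hR0 : 0 ≤ R) (hR : R ≤ 1)
    (hμR : μ * R ≤ 1) : StrictConcaveOn ℝ (Set.Icc 0 R) (timeMap μ) := by
  refine ⟨convex_Icc _ _, fun x hx y hy hxy a b ha hb hab => ?_⟩
  simp only [timeMap_eq_integral, smul_eq_mul]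
  have hi : ∀ ρ, IntervalIntegrable (fun z => timeKernel μ ρ z) MeasureTheory.volume 0 1 :=
    fun ρ => (continuous_timeKernel_right μ ρ).intervalIntegrable _ _
  have hlt : ∀ z ∈ Set.Ioc (0 : ℝ) 1,
      a * timeKernel μ x z + b * timeKernel μ y z < timeKernel μ (a * x + b * y) z :=
    fun z hz => (strictConcaveOn_timeKernel hμ hR0 hR hμR hz.1 hz.2).2 hx hy hxy ha hb hab
  have key : ∫ z in (0 : ℝ)..1, (a * timeKernel μ x z + b * timeKernel μ y z)
      < ∫ z in (0 : ℝ)..1, timeKernel μ (a * x + b * y) z := by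
    refine intervalIntegral.integral_lt_integral_of_continuousOn_of_le_of_exists_lt one_pos
      (by have := continuous_timeKernel_right μ x; have := continuous_timeKernel_right μ y; fun_prop)
      (continuous_timeKernel_right μ _).continuousOn (fun z hz => (hlt z hz).le)
      ⟨1, by simp, hlt 1 (by simp)⟩
  rw [intervalIntegral.integral_add ((hi x).const_mul a) ((hi y).const_mul b),
    intervalIntegral.integral_const_mul, intervalIntegral.integral_const_mul] at key
  have h2 : 0 < 2 / μ := by positivity
  have := mul_lt_mul_of_pos_left key h2
  linarith

/-! ### Strict decrease of the time map for `ρ ≥ 1`. -/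

/-- With `B² = 1 + ρ²` the denominator factors through `(B + ρ z) (B - ρ z)`. At `z = 1` this
product is `1`, so the two logarithms merge into `arsinh ρ`. -/
theorem integral_inv_sq_eq {ρ : ℝ} (hρ : 0 < ρ) :
    ∫ z in (0 : ℝ)..1, ρ / (1 + ρ ^ 2 * (1 - z ^ 2)) ^ 2
      = ρ / (2 * (1 + ρ ^ 2)) + Real.arsinh ρ / (2 * Real.sqrt (1 + ρ ^ 2) ^ 3) := by
  obtain ⟨B, hB⟩ : ∃ B, B = Real.sqrt (1 + ρ ^ 2) := ⟨_, rfl⟩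
  have hBsq : B ^ 2 = 1 + ρ ^ 2 := by rw [hB]; exact Real.sq_sqrt (by positivity)
  have hB0 : 0 < B := by rw [hB]; positivity
  have hBρ : ρ < B := by nlinarith
  have hpos : ∀ z ∈ Set.uIcc (0 : ℝ) 1, 0 < B + ρ * z ∧ 0 < B - ρ * z := by
    intro z hz
    rw [Set.uIcc_of_le zero_le_one] at hz
    have h1 : 0 ≤ ρ * z := mul_nonneg hρ.le hz.1
    have h2 : ρ * z ≤ ρ := by nlinarith [hz.2]
    constructor <;> linarith
  have hderiv : ∀ z ∈ Set.uIcc (0 : ℝ) 1, HasDerivAt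
      (fun z : ℝ => ρ * z / (2 * B ^ 2 * (B ^ 2 - ρ ^ 2 * z ^ 2))
        + 1 / (4 * B ^ 3) * (Real.log (B + ρ * z) - Real.log (B - ρ * z)))
      (ρ / (1 + ρ ^ 2 * (1 - z ^ 2)) ^ 2) z := by
    intro z hz
    obtain ⟨h1, h2⟩ := hpos z hz
    have h3 : 0 < B ^ 2 - ρ ^ 2 * z ^ 2 := by nlinarith [mul_pos h1 h2]
    have hlin : HasDerivAt (fun z : ℝ => ρ * z) ρ z := by
      simpa using (hasDerivAt_id z).const_mul ρ
    have hq : HasDerivAt (fun z : ℝ => 2 * B ^ 2 * (B ^ 2 - ρ ^ 2 * z ^ 2))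
        (2 * B ^ 2 * (-(ρ ^ 2 * (2 * z)))) z := by
      simpa using (((hasDerivAt_pow 2 z).const_mul (ρ ^ 2)).const_sub (B ^ 2)).const_mul (2 * B ^ 2)
    have := (hlin.div hq (by positivity)).add
      ((((hlin.const_add B).log h1.ne').sub ((hlin.const_sub B).log h2.ne')).const_mul (1 / (4 * B ^ 3)))
    refine this.congr_deriv ?_
    rw [show 1 + ρ ^ 2 * (1 - z ^ 2) = (B + ρ * z) * (B - ρ * z) by linear_combination -hBsq]
    rw [show B ^ 2 - ρ ^ 2 * z ^ 2 = (B + ρ * z) * (B - ρ * z) by ring]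
    have h1' := h1.ne'
    have h2' := h2.ne'
    field_simp
    ring
  rw [intervalIntegral.integral_eq_sub_of_hasDerivAt hderiv]
  · have hlog : Real.log (B - ρ) = -Real.log (B + ρ) := by
      rw [← Real.log_inv]
      congr 1
      refine eq_inv_of_mul_eq_one_left ?_
      linear_combination hBsq
    have harsinh : Real.arsinh ρ = Real.log (B + ρ) := by
      rw [Real.arsinh, hB, add_comm]
    rw [← hB, harsinh, ← hBsq]
    simp only [mul_one, mul_zero, one_pow, hlog]
    rw [show B ^ 2 - ρ ^ 2 = 1 by linear_combination hBsq]
    simp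
    ring
  · refine ContinuousOn.intervalIntegrable ?_
    refine ContinuousOn.div continuousOn_const (by fun_prop) fun z hz => ?_
    obtain ⟨h1, h2⟩ := hpos z hz
    have : 1 + ρ ^ 2 * (1 - z ^ 2) = (B + ρ * z) * (B - ρ * z) := by linear_combination -hBsq
    rw [this]
    positivity

theorem strictAntiOn_integral_inv_sq :
    StrictAntiOn (fun ρ : ℝ => ∫ z in (0 : ℝ)..1, ρ / (1 + ρ ^ 2 * (1 - z ^ 2)) ^ 2)
      (Set.Ici 1) := by
  have hD : ∀ ρ : ℝ, HasDerivAt (fun ρ : ℝ => ρ / (2 * (1 + ρ ^ 2))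
      + Real.arsinh ρ / (2 * Real.sqrt (1 + ρ ^ 2) ^ 3))
      ((2 - ρ ^ 2 - 3 * Real.arsinh ρ * (ρ / Real.sqrt (1 + ρ ^ 2)))
        / (2 * Real.sqrt (1 + ρ ^ 2) ^ 4)) ρ := by
    intro ρ
    have hp : 0 < 1 + ρ ^ 2 := by positivity
    have hB0 : 0 < Real.sqrt (1 + ρ ^ 2) := Real.sqrt_pos.2 hp
    have hBsq : Real.sqrt (1 + ρ ^ 2) ^ 2 = 1 + ρ ^ 2 := Real.sq_sqrt hp.le
    have hq : HasDerivAt (fun ρ : ℝ => 1 + ρ ^ 2) (2 * ρ) ρ := by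
      simpa using (hasDerivAt_pow 2 ρ).const_add 1
    have := ((hasDerivAt_id ρ).div (hq.const_mul 2) (by positivity)).add
      ((Real.hasDerivAt_arsinh ρ).div (((hq.sqrt hp.ne').pow 3).const_mul 2)
        (mul_ne_zero two_ne_zero (pow_ne_zero 3 hB0.ne')))
    refine this.congr_deriv ?_
    simp only [id, Pi.pow_apply]
    set B := Real.sqrt (1 + ρ ^ 2) with hBdef
    have hρ : ρ ^ 2 = B ^ 2 - 1 := by linarith
    rw [hρ]
    have : (1 + (B ^ 2 - 1)) = B ^ 2 := by ring
    rw [this]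
    field_simp
    push_cast
    ring_nf
    rw [hρ]
    ring
  have : StrictAntiOn (fun ρ : ℝ => ρ / (2 * (1 + ρ ^ 2))
      + Real.arsinh ρ / (2 * Real.sqrt (1 + ρ ^ 2) ^ 3)) (Set.Ici 1) := by
    refine strictAntiOn_of_deriv_neg (convex_Ici 1)
      (fun x _ => (hD x).continuousAt.continuousWithinAt) fun x hx => ?_
    rw [interior_Ici] at hx
    have hx1 : 1 < x := hx
    have hp : 0 < 1 + x ^ 2 := by positivity
    have hB0 : 0 < Real.sqrt (1 + x ^ 2) := Real.sqrt_pos.2 hp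
    have hBsq : Real.sqrt (1 + x ^ 2) ^ 2 = 1 + x ^ 2 := Real.sq_sqrt hp.le
    rw [(hD x).deriv]
    refine div_neg_of_neg_of_pos ?_ (by positivity)
    -- For `x > 1` one has `2 - x² < 1`, while these two bounds make the subtracted term exceed `3 ·
    -- (1/2) · (2/3) = 1`.
    have h1 : 2 / 3 < x / Real.sqrt (1 + x ^ 2) := by
      rw [div_lt_div_iff₀ (by norm_num) hB0]
      nlinarith
    have h2 : 1 / 2 ≤ Real.arsinh x := by
      rw [Real.arsinh]
      have hge : 2 ≤ x + Real.sqrt (1 + x ^ 2) := by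
        have : 1 ≤ Real.sqrt (1 + x ^ 2) := Real.one_le_sqrt.2 (by nlinarith)
        linarith
      refine le_trans ?_ (Real.one_sub_inv_le_log_of_pos (by linarith))
      have := inv_anti₀ two_pos hge
      linarith
    nlinarith
  exact this.congr fun x hx => (integral_inv_sq_eq (lt_of_lt_of_le one_pos hx)).symm

theorem timeKernel_eq {μ ρ z : ℝ} (hz : z ∈ Set.Icc (0 : ℝ) 1) :
    timeKernel μ ρ z = angleWeight (μ * ρ * z) * (ρ / (1 + ρ ^ 2 * (1 - z ^ 2)) ^ 2) := by
  rw [timeKernel, abs_of_nonneg (by nlinarith [hz.1, hz.2])]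
  ring

/-- As functions of `d`, the two kernels cross once, at a point of `(0, 1]`. -/
theorem exists_kernel_crossing {ρ₁ ρ₂ : ℝ} (h1 : 1 ≤ ρ₁) (h12 : ρ₁ < ρ₂) :
    ∃ d₀ : ℝ, 0 < d₀ ∧ d₀ ≤ 1 ∧
      (∀ d, d₀ ≤ d → ρ₂ / (1 + ρ₂ ^ 2 * d) ^ 2 ≤ ρ₁ / (1 + ρ₁ ^ 2 * d) ^ 2) ∧
      (∀ d, 0 ≤ d → d ≤ d₀ → ρ₁ / (1 + ρ₁ ^ 2 * d) ^ 2 ≤ ρ₂ / (1 + ρ₂ ^ 2 * d) ^ 2) := by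
  obtain ⟨a, ha1, rfl⟩ : ∃ a : ℝ, 1 ≤ a ∧ ρ₁ = a ^ 2 :=
    ⟨Real.sqrt ρ₁, Real.one_le_sqrt.2 h1, (Real.sq_sqrt (by linarith)).symm⟩
  obtain ⟨b, hb1, rfl⟩ : ∃ b : ℝ, 1 ≤ b ∧ ρ₂ = b ^ 2 :=
    ⟨Real.sqrt ρ₂, Real.one_le_sqrt.2 (by linarith), (Real.sq_sqrt (by linarith)).symm⟩
  have hab : a < b := lt_of_pow_lt_pow_left₀ 2 (by linarith) h12
  have ha : 0 < a := by linarith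
  have hb : 0 < b := by linarith
  have hc : 0 < a * b * (a ^ 2 + a * b + b ^ 2) := by positivity
  -- Both kernels are squares, so it suffices to compare `a / (1 + a⁴ d)` with `b / (1 + b⁴ d)`.
  -- After cross-multiplying, the difference is `(b - a) (a b (a² + a b + b²) d - 1)`, which gives
  -- `d₀`.
  have hsq : ∀ x d : ℝ, x ^ 2 / (1 + (x ^ 2) ^ 2 * d) ^ 2 = (x / (1 + x ^ 4 * d)) ^ 2 := by
    intro x d; rw [div_pow]; ring_nf
  refine ⟨1 / (a * b * (a ^ 2 + a * b + b ^ 2)), by positivity, ?_, fun d hd => ?_, fun d hd0 hd => ?_⟩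
  · rw [div_le_one hc]
    have : 1 ≤ a * b := by nlinarith
    nlinarith
  · have hd0 : 0 ≤ d := le_trans (by positivity) hd
    rw [div_le_iff₀ hc] at hd
    rw [hsq, hsq]
    refine pow_le_pow_left₀ (by positivity) ?_ 2
    rw [div_le_div_iff₀ (by positivity) (by positivity)]
    nlinarith [mul_le_mul_of_nonneg_left hd (sub_nonneg.2 hab.le)]
  · rw [le_div_iff₀ hc] at hd
    rw [hsq, hsq]
    refine pow_le_pow_left₀ (by positivity) ?_ 2
    rw [div_le_div_iff₀ (by positivity) (by positivity)]
    nlinarith [mul_le_mul_of_nonneg_left hd (sub_nonneg.2 hab.le)]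

/-- A Chebyshev-type argument. The unweighted integral already decreases, and the difference of the
kernels for `ρ₁ < ρ₂` changes sign once, from positive to negative as `z` passes `z₀`. The weight
decreases in `z`, so weighting the difference gives at least its value at `z₀` times the unweighted
difference. Replacing `ρ₁` by `ρ₂` inside the weight only helps. -/
theorem strictAntiOn_timeMap_of_one_le {μ : ℝ} (hμ : 0 < μ) :
    StrictAntiOn (timeMap μ) (Set.Icc 1 (1 / μ)) := by
  intro ρ₁ h1 ρ₂ h2 h12
  have hμ2 : μ * ρ₂ ≤ 1 := by have := h2.2; rwa [le_div_iff₀ hμ, mul_comm] at this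
  have hρ1 : 0 < ρ₁ := lt_of_lt_of_le one_pos h1.1
  have hρ2 : 0 < ρ₂ := hρ1.trans h12
  have hμ1 : μ * ρ₁ < 1 := lt_of_lt_of_le (mul_lt_mul_of_pos_left h12 hμ) hμ2
  obtain ⟨d₀, hd0, hd1, hge, hle⟩ := exists_kernel_crossing h1.1 h12
  obtain ⟨z₀, hz0, hz⟩ : ∃ z₀ : ℝ, 0 ≤ z₀ ∧ z₀ ^ 2 = 1 - d₀ :=
    ⟨Real.sqrt (1 - d₀), Real.sqrt_nonneg _, Real.sq_sqrt (by linarith)⟩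
  have hz1 : z₀ < 1 := by nlinarith
  have hGpos : 0 < angleWeight (μ * ρ₁ * z₀) := by
    refine angleWeight_pos ?_
    have h0 : 0 ≤ μ * ρ₁ := by positivity
    have : μ * ρ₁ * z₀ < 1 := by nlinarith
    have : 0 ≤ μ * ρ₁ * z₀ := by positivity
    nlinarith
  have hcont : ∀ ρ : ℝ, ContinuousOn (fun z : ℝ => ρ / (1 + ρ ^ 2 * (1 - z ^ 2)) ^ 2)
      (Set.uIcc 0 1) := by
    intro ρ
    refine ContinuousOn.div continuousOn_const (by fun_prop) fun z hz => ?_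
    rw [Set.uIcc_of_le zero_le_one] at hz
    have : 0 ≤ 1 - z ^ 2 := by nlinarith [hz.1, hz.2]
    positivity
  have hint := fun ρ => (hcont ρ).intervalIntegrable (μ := MeasureTheory.volume)
  have hmono : angleWeight (μ * ρ₁ * z₀) *
      ((∫ z in (0 : ℝ)..1, ρ₁ / (1 + ρ₁ ^ 2 * (1 - z ^ 2)) ^ 2)
        - ∫ z in (0 : ℝ)..1, ρ₂ / (1 + ρ₂ ^ 2 * (1 - z ^ 2)) ^ 2)
      ≤ (∫ z in (0 : ℝ)..1, timeKernel μ ρ₁ z) - ∫ z in (0 : ℝ)..1, timeKernel μ ρ₂ z := by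
    have hk := fun ρ => (continuous_timeKernel_right μ ρ).intervalIntegrable (μ := MeasureTheory.volume) 0 1
    rw [← intervalIntegral.integral_sub (hint ρ₁) (hint ρ₂),
      ← intervalIntegral.integral_sub (hk ρ₁) (hk ρ₂), ← intervalIntegral.integral_const_mul]
    refine intervalIntegral.integral_mono_on zero_le_one (((hint ρ₁).sub (hint ρ₂)).const_mul _)
      ((hk ρ₁).sub (hk ρ₂)) fun z hzz => ?_
    rw [timeKernel_eq hzz, timeKernel_eq hzz]
    have hd : 0 ≤ 1 - z ^ 2 := by nlinarith [hzz.1, hzz.2]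
    have hG12 : angleWeight (μ * ρ₂ * z) ≤ angleWeight (μ * ρ₁ * z) := by
      refine angleWeight_le_of_le (mul_nonneg (by positivity) hzz.1) ?_ ?_
      · exact mul_le_mul_of_nonneg_right (mul_le_mul_of_nonneg_left h12.le hμ.le) hzz.1
      · have : 0 ≤ μ * ρ₂ := by positivity
        nlinarith [hzz.1, hzz.2]
    have hB2 : 0 ≤ ρ₂ / (1 + ρ₂ ^ 2 * (1 - z ^ 2)) ^ 2 := by positivity
    have hs1 := mul_le_mul_of_nonneg_right hG12 hB2
    have h0 : 0 ≤ μ * ρ₁ := by positivity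
    have hbound : ∀ x ∈ Set.Icc (0 : ℝ) 1, μ * ρ₁ * x ≤ 1 := fun x hx => by nlinarith [hx.1, hx.2]
    rcases le_total z z₀ with h | h
    · have hs2 := hge (1 - z ^ 2) (by nlinarith [hzz.1])
      have hs3 : angleWeight (μ * ρ₁ * z₀) ≤ angleWeight (μ * ρ₁ * z) :=
        angleWeight_le_of_le (mul_nonneg h0 hzz.1) (mul_le_mul_of_nonneg_left h h0)
          (hbound z₀ ⟨hz0, hz1.le⟩)
      nlinarith [mul_nonneg (sub_nonneg.2 hs2) (sub_nonneg.2 hs3)]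
    · have hs2 := hle (1 - z ^ 2) hd (by nlinarith [hzz.1])
      have hs3 : angleWeight (μ * ρ₁ * z) ≤ angleWeight (μ * ρ₁ * z₀) :=
        angleWeight_le_of_le (mul_nonneg h0 hz0) (mul_le_mul_of_nonneg_left h h0) (hbound z hzz)
      nlinarith [mul_nonneg (sub_nonneg.2 hs2) (sub_nonneg.2 hs3)]
  have hanti := strictAntiOn_integral_inv_sq (Set.mem_Ici.2 h1.1) (Set.mem_Ici.2 h2.1) h12
  simp only at hanti
  have := mul_pos hGpos (sub_pos.2 hanti)
  rw [timeMap_eq_integral, timeMap_eq_integral]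
  exact mul_lt_mul_of_pos_left (by linarith) (by positivity)

/-! ### The endpoint `1/μ` and the single peak of the time map. -/

/-- Move `ρ` slightly below `P = 1/μ`. The lost piece of the integral is `o(P - ρ)`, because the
weight vanishes at `1`; the smaller denominators gain at least a fixed multiple of `P - ρ`. -/
theorem exists_timeMap_gt_endpoint {μ : ℝ} (hμ : 0 < μ) :
    ∃ ρ, 0 < ρ ∧ ρ < 1 / μ ∧ timeMap μ (1 / μ) < timeMap μ ρ := by
  obtain ⟨P, hP⟩ : ∃ P, P = 1 / μ := ⟨_, rfl⟩
  have hP0 : 0 < P := by rw [hP]; positivity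
  have hμP : μ * P = 1 := by rw [hP]; field_simp
  rw [← hP]
  have hGc : Continuous fun t : ℝ => angleWeight (μ * t) :=
    continuous_angleWeight.comp (by fun_prop)
  have hGnn : ∀ t ∈ Set.Icc 0 P, 0 ≤ angleWeight (μ * t) := fun t ht =>
    angleWeight_nonneg <| by
      have h1 := mul_le_mul_of_nonneg_left ht.2 hμ.le
      have h2 := mul_nonneg hμ.le ht.1
      nlinarith
  set κ := ∫ t in (0 : ℝ)..(P / 2), angleWeight (μ * t) with hκ
  have hκ0 : 0 < κ := by
    refine intervalIntegral.intervalIntegral_pos_of_pos_on (hGc.intervalIntegrable _ _)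
      (fun t ht => angleWeight_pos ?_) (by positivity)
    have : μ * t < 1 := by nlinarith [ht.2]
    nlinarith [mul_pos hμ ht.1]
  -- The gain per unit of `P - ρ` and of weight: `1 / A² - 1 / B² ≥ (B - A) / B³` for the two
  -- denominators `A ≤ B`, with `B - A ≥ (P - ρ) P` and `B ≤ 1 + P²`.
  set C := P / (1 + P ^ 2) ^ 3 with hC
  have hC0 : 0 < C := by positivity
  have hev : ∀ᶠ ρ in nhds P, angleWeight (μ * ρ) < C * κ := by
    refine hGc.continuousAt.eventually_lt_const ?_
    show angleWeight (μ * P) < C * κ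
    rw [hμP, angleWeight_one]; positivity
  obtain ⟨ρ, hρG, hρ2, hρP⟩ : ∃ ρ, angleWeight (μ * ρ) < C * κ ∧ P / 2 < ρ ∧ ρ < P := by
    have h1 : ∀ᶠ ρ in nhdsWithin P (Set.Iio P), P / 2 < ρ :=
      (lt_mem_nhds (by linarith)).filter_mono nhdsWithin_le_nhds
    obtain ⟨ρ, h⟩ := ((hev.filter_mono nhdsWithin_le_nhds).and
      (h1.and self_mem_nhdsWithin)).exists
    exact ⟨ρ, h.1, h.2.1, h.2.2⟩
  have hρ0 : 0 < ρ := by linarith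
  refine ⟨ρ, hρ0, hρP, ?_⟩
  rw [timeMap, timeMap, profileX, profileX]
  refine mul_lt_mul_of_pos_left ?_ (by positivity)
  have hi := fun ρ a b => (continuous_profile_integrand μ ρ).intervalIntegrable
    (μ := MeasureTheory.volume) a b
  rw [← intervalIntegral.integral_add_adjacent_intervals (hi P 0 ρ) (hi P ρ P)]
  have hfar : ∫ t in ρ..P, angleWeight (μ * t) / (1 + |P ^ 2 - t ^ 2|) ^ 2
      ≤ (P - ρ) * angleWeight (μ * ρ) := by
    have : ∫ t in ρ..P, angleWeight (μ * t) / (1 + |P ^ 2 - t ^ 2|) ^ 2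
        ≤ ∫ t in ρ..P, angleWeight (μ * ρ) := by
      refine intervalIntegral.integral_mono_on hρP.le (hi P ρ P) (by simp) fun t ht => ?_
      have hG := angleWeight_le_of_le (mul_nonneg hμ.le hρ0.le)
        (mul_le_mul_of_nonneg_left ht.1 hμ.le) (by nlinarith [ht.2])
      refine (div_le_self (hGnn t ⟨hρ0.le.trans ht.1, ht.2⟩) ?_).trans hG
      exact one_le_pow₀ (by linarith [abs_nonneg (P ^ 2 - t ^ 2)])
    simpa using this
  have hnear : (∫ t in (0 : ℝ)..ρ, angleWeight (μ * t) / (1 + |P ^ 2 - t ^ 2|) ^ 2)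
      + (P - ρ) * (C * κ) ≤ ∫ t in (0 : ℝ)..ρ, angleWeight (μ * t) / (1 + |ρ ^ 2 - t ^ 2|) ^ 2 := by
    have hκρ : κ ≤ ∫ t in (0 : ℝ)..ρ, angleWeight (μ * t) := by
      rw [hκ, ← intervalIntegral.integral_add_adjacent_intervals
        (hGc.intervalIntegrable 0 (P / 2)) (hGc.intervalIntegrable (P / 2) ρ)]
      have := intervalIntegral.integral_nonneg (μ := MeasureTheory.volume) hρ2.le
        (fun t (ht : t ∈ Set.Icc (P / 2) ρ) => hGnn t ⟨by linarith [ht.1], by linarith [ht.2]⟩)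
      linarith
    have hle : (∫ t in (0 : ℝ)..ρ, angleWeight (μ * t) / (1 + |P ^ 2 - t ^ 2|) ^ 2)
        + ∫ t in (0 : ℝ)..ρ, (P - ρ) * C * angleWeight (μ * t)
        ≤ ∫ t in (0 : ℝ)..ρ, angleWeight (μ * t) / (1 + |ρ ^ 2 - t ^ 2|) ^ 2 := by
      rw [← intervalIntegral.integral_add (hi P 0 ρ) ((hGc.intervalIntegrable 0 ρ).const_mul _)]
      refine intervalIntegral.integral_mono_on hρ0.le
        ((hi P 0 ρ).add ((hGc.intervalIntegrable 0 ρ).const_mul _)) (hi ρ 0 ρ) fun t ht => ?_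
      have hG := hGnn t ⟨ht.1, ht.2.trans hρP.le⟩
      have htρ : t ^ 2 ≤ ρ ^ 2 := by nlinarith [ht.1, ht.2]
      have hρPsq : ρ ^ 2 < P ^ 2 := by nlinarith
      rw [abs_of_nonneg (by linarith), abs_of_nonneg (by linarith)]
      set A := 1 + (ρ ^ 2 - t ^ 2) with hA
      have hA1 : 1 ≤ A := by linarith
      set B := 1 + (P ^ 2 - t ^ 2) with hB
      have hAB : A ≤ B := by linarith
      have hBP : B ≤ 1 + P ^ 2 := by nlinarith
      have hBA : (P - ρ) * P ≤ B - A := by nlinarith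
      have hkey : 1 / B ^ 2 + (P - ρ) * C ≤ 1 / A ^ 2 := by
        have hB0 : 0 < B := by linarith
        have hA0 : 0 < A := by linarith
        have h1 : (P - ρ) * C ≤ (B - A) / B ^ 3 := by
          rw [hC, ← mul_div_assoc]
          gcongr
        have h2 : 1 / B ^ 2 + (B - A) / B ^ 3 ≤ 1 / A ^ 2 := by
          rw [div_add_div _ _ (by positivity) (by positivity),
            div_le_div_iff₀ (by positivity) (by positivity)]
          have : A * A ≤ B * B := by nlinarith
          have h3 : 0 ≤ B ^ 2 * (B - A) * (B * B - A * A) :=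
            mul_nonneg (mul_nonneg (by positivity) (by linarith)) (by linarith)
          have h4 : 0 ≤ B ^ 3 * A * (B - A) := mul_nonneg (by positivity) (by linarith)
          have h5 : 0 ≤ B ^ 2 * (B - A) * (A * (B - A)) :=
            mul_nonneg (mul_nonneg (by positivity) (by linarith))
              (mul_nonneg hA0.le (by linarith))
          nlinarith
        linarith
      calc angleWeight (μ * t) / B ^ 2 + (P - ρ) * C * angleWeight (μ * t)
          = angleWeight (μ * t) * (1 / B ^ 2 + (P - ρ) * C) := by ring
        _ ≤ angleWeight (μ * t) * (1 / A ^ 2) := mul_le_mul_of_nonneg_left hkey hG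
        _ = angleWeight (μ * t) / A ^ 2 := by ring
    rw [intervalIntegral.integral_const_mul] at hle
    have h0 : 0 ≤ (P - ρ) * C := mul_nonneg (by linarith) hC0.le
    nlinarith [mul_le_mul_of_nonneg_left hκρ h0]
  have := mul_lt_mul_of_pos_left hρG (sub_pos.2 hρP)
  linarith

theorem StrictConcaveOn.strictMonoOn_of_isMaxOn {f : ℝ → ℝ} {a b r : ℝ}
    (hf : StrictConcaveOn ℝ (Set.Icc a b) f) (hr : r ∈ Set.Icc a b)
    (hmax : IsMaxOn f (Set.Icc a b) r) : StrictMonoOn f (Set.Icc a r) := by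
  have key : ∀ x y, a ≤ x → x < y → y < r → f x < f y := by
    intro x y hx hxy hyr
    have := hf.slope_anti_adjacent ⟨hx, (hxy.trans hyr).le.trans hr.2⟩ hr hxy hyr
    have h1 : 0 ≤ (f r - f y) / (r - y) :=
      div_nonneg (sub_nonneg.2 (hmax ⟨hx.trans hxy.le, hyr.le.trans hr.2⟩)) (by linarith)
    have h2 := h1.trans_lt this
    rw [div_pos_iff_of_pos_right (by linarith)] at h2
    linarith
  intro x hx y hy hxy
  rcases hy.2.lt_or_eq with h | h
  · exact key x y hx.1 hxy h
  · rw [h] at hxy ⊢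
    have := key x ((x + r) / 2) hx.1 (by linarith) (by linarith)
    exact this.trans_le (hmax ⟨by linarith [hx.1], by linarith [hr.2]⟩)

theorem StrictConcaveOn.strictAntiOn_of_isMaxOn {f : ℝ → ℝ} {a b r : ℝ}
    (hf : StrictConcaveOn ℝ (Set.Icc a b) f) (hr : r ∈ Set.Icc a b)
    (hmax : IsMaxOn f (Set.Icc a b) r) : StrictAntiOn f (Set.Icc r b) := by
  have key : ∀ x y, r < x → x < y → y ≤ b → f y < f x := by
    intro x y hx hxy hyb
    have := hf.slope_anti_adjacent hr ⟨hr.1.trans (hx.trans hxy).le, hyb⟩ hx hxy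
    have h1 : (f x - f r) / (x - r) ≤ 0 :=
      div_nonpos_of_nonpos_of_nonneg
        (sub_nonpos.2 (hmax ⟨hr.1.trans hx.le, hxy.le.trans hyb⟩)) (by linarith)
    have h2 := this.trans_le h1
    rw [div_neg_iff] at h2
    rcases h2 with h2 | h2 <;> linarith [h2.1, h2.2]
  intro x hx y hy hxy
  rcases hx.1.lt_or_eq with h | h
  · exact key x y h hxy hy.2
  · rw [← h] at hxy ⊢
    have := key ((r + y) / 2) y (by linarith) (by linarith) hy.2
    exact this.trans_le (hmax ⟨by linarith [hr.1], by linarith [hy.2]⟩)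

theorem timeMap_pos {μ ρ : ℝ} (hμ : 0 < μ) (hρ : 0 < ρ) (h : μ * ρ ≤ 1) : 0 < timeMap μ ρ := by
  have := strictMonoOn_profileX hμ h (a := 0) ⟨by linarith, hρ.le⟩ ⟨by linarith, le_rfl⟩ hρ
  simpa [timeMap, profileX] using this

/-- The peak is the maximum point of the strictly concave part on `[0, min 1 (1/μ)]`. If `1 < 1/μ`,
the decrease is continued by `strictAntiOn_timeMap_of_one_le`; otherwise
`exists_timeMap_gt_endpoint` keeps the maximum off `1/μ`. -/
theorem exists_timeMap_peak {μ : ℝ} (hμ : 0 < μ) :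
    ∃ r, 0 < r ∧ r ≤ 1 ∧ r < 1 / μ ∧ StrictMonoOn (timeMap μ) (Set.Icc 0 r) ∧
      StrictAntiOn (timeMap μ) (Set.Icc r (1 / μ)) := by
  obtain ⟨c, hc⟩ : ∃ c, c = min 1 (1 / μ) := ⟨_, rfl⟩
  have hc0 : 0 < c := by rw [hc]; positivity
  have hc1 : c ≤ 1 := hc ▸ min_le_left _ _
  have hcμ' : c ≤ 1 / μ := hc ▸ min_le_right _ _
  have hcμ : μ * c ≤ 1 := by rwa [le_div_iff₀ hμ, mul_comm] at hcμ'
  have hconc := strictConcaveOn_timeMap hμ hc0.le hc1 hcμ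
  obtain ⟨r, hr, hmax⟩ := isCompact_Icc.exists_isMaxOn (Set.nonempty_Icc.2 hc0.le)
    (continuous_timeMap_right μ).continuousOn
  have hr0 : 0 < r := by
    refine lt_of_le_of_ne hr.1 fun h => ?_
    have h1 : timeMap μ c ≤ timeMap μ r := hmax ⟨hc0.le, le_rfl⟩
    rw [← h, timeMap_zero] at h1
    exact absurd (timeMap_pos hμ hc0 hcμ) (not_lt.2 h1)
  have hanti := hconc.strictAntiOn_of_isMaxOn hr hmax
  refine ⟨r, hr0, hr.2.trans hc1, ?_, hconc.strictMonoOn_of_isMaxOn hr hmax, ?_⟩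
  · rcases lt_or_ge 1 (1 / μ) with h | h
    · exact (hr.2.trans hc1).trans_lt h
    · refine lt_of_le_of_ne (hr.2.trans hcμ') fun h' => ?_
      obtain ⟨ρ, hρ0, hρ, hlt⟩ := exists_timeMap_gt_endpoint hμ
      have hρc : ρ ≤ c := by rw [hc, min_eq_right h]; exact hρ.le
      have h1 : timeMap μ ρ ≤ timeMap μ r := hmax ⟨hρ0.le, hρc⟩
      rw [h'] at h1
      exact absurd hlt (not_lt.2 h1)
  · rcases lt_or_ge 1 (1 / μ) with h | h
    · rw [min_eq_left h.le] at hc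
      rw [← Set.Icc_union_Icc_eq_Icc (hr.2.trans hc1) h.le]
      rw [hc] at hanti
      exact hanti.union (strictAntiOn_timeMap_of_one_le hμ)
        (isGreatest_Icc (hr.2.trans hc1)) (isLeast_Icc h.le)
    · rw [min_eq_right h] at hc
      rwa [hc] at hanti

/-! ### Dependence on `μ` and a priori bounds. -/

theorem integral_timeKernel_anti {μ₁ μ₂ ρ : ℝ} (hμ₁ : 0 < μ₁) (h12 : μ₁ ≤ μ₂) (hρ : 0 ≤ ρ)
    (h : μ₂ * ρ ≤ 1) :
    ∫ z in (0 : ℝ)..1, timeKernel μ₂ ρ z ≤ ∫ z in (0 : ℝ)..1, timeKernel μ₁ ρ z := by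
  refine intervalIntegral.integral_mono_on zero_le_one
    ((continuous_timeKernel_right _ _).intervalIntegrable _ _)
    ((continuous_timeKernel_right _ _).intervalIntegrable _ _) fun z hz => ?_
  rw [timeKernel, timeKernel]
  have hz0 := hz.1
  have hle : μ₁ * ρ * z ≤ μ₂ * ρ * z := by gcongr
  have h0 : 0 ≤ μ₂ * ρ := mul_nonneg (hμ₁.le.trans h12) hρ
  have := angleWeight_le_of_le (by positivity : 0 ≤ μ₁ * ρ * z) hle (by nlinarith [hz.2])
  gcongr

theorem timeMap_strictAnti_left {μ₁ μ₂ ρ : ℝ} (hμ₁ : 0 < μ₁) (h12 : μ₁ < μ₂) (hρ : 0 < ρ)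
    (h : μ₂ * ρ ≤ 1) : timeMap μ₂ ρ < timeMap μ₁ ρ := by
  have hle := integral_timeKernel_anti hμ₁ h12.le hρ.le h
  have hpos := timeMap_pos (hμ₁.trans h12) hρ h
  rw [timeMap_eq_integral] at hpos ⊢
  rw [timeMap_eq_integral]
  have h2 : 0 < 2 / μ₂ := by have := hμ₁.trans h12; positivity
  have hI := (mul_pos_iff_of_pos_left h2).1 hpos
  have : 2 / μ₂ < 2 / μ₁ := div_lt_div_of_pos_left two_pos hμ₁ h12
  nlinarith

/-- Dropping the denominator, which is at least `1`, leaves an exact integral equal to the sine of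
the boundary angle. -/
theorem sq_mul_timeMap_lt_one {μ ρ : ℝ} (hμ : 0 < μ) (hρ : 0 < ρ) (h : μ * ρ ≤ 1) :
    μ ^ 2 * timeMap μ ρ < 1 := by
  have hsq : ∀ t ∈ Set.Icc 0 ρ, (μ * t) ^ 2 ≤ 1 := fun t ht => by
    have h1 := mul_le_mul_of_nonneg_left ht.2 hμ.le
    have h2 := mul_nonneg hμ.le ht.1
    nlinarith
  have hG : Continuous fun t : ℝ => angleWeight (μ * t) :=
    continuous_angleWeight.comp (by fun_prop)
  have hint : ∫ t in (0 : ℝ)..ρ, 2 * μ * angleWeight (μ * t)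
      = μ * ρ * Real.sqrt (2 - (μ * ρ) ^ 2) := by
    rw [intervalIntegral.integral_eq_sub_of_hasDerivAt
      (f := fun t => μ * t * Real.sqrt (2 - (μ * t) ^ 2))]
    · simp
    · intro t ht
      rw [Set.uIcc_of_le hρ.le] at ht
      have h1 := hsq t ht
      have := (hasDerivAt_mul_sqrt (by linarith) h1).comp t ((hasDerivAt_id t).const_mul μ)
      refine this.congr_deriv ?_
      simp; ring
    · exact (continuous_const.mul hG).intervalIntegrable _ _
  have hle1 : μ * ρ * Real.sqrt (2 - (μ * ρ) ^ 2) ≤ 1 := by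
    have h1 := hsq ρ ⟨hρ.le, le_rfl⟩
    have h2 : Real.sqrt (2 - (μ * ρ) ^ 2) ^ 2 = 2 - (μ * ρ) ^ 2 := Real.sq_sqrt (by linarith)
    nlinarith [sq_nonneg (μ * ρ - Real.sqrt (2 - (μ * ρ) ^ 2))]
  refine lt_of_lt_of_le ?_ hle1
  rw [← hint, timeMap, profileX]
  have : ∫ t in (0 : ℝ)..ρ, angleWeight (μ * t) / (1 + |ρ ^ 2 - t ^ 2|) ^ 2
      < ∫ t in (0 : ℝ)..ρ, angleWeight (μ * t) := by
    refine intervalIntegral.integral_lt_integral_of_continuousOn_of_le_of_exists_lt hρ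
      (continuous_profile_integrand μ ρ).continuousOn hG.continuousOn (fun t ht => ?_)
      ⟨0, ⟨le_rfl, hρ.le⟩, ?_⟩
    · exact div_le_self (angleWeight_nonneg (hsq t ⟨ht.1.le, ht.2⟩))
        (one_le_pow₀ (by linarith [abs_nonneg (ρ ^ 2 - t ^ 2)]))
    · refine div_lt_self (angleWeight_pos (by simp)) (one_lt_pow₀ ?_ two_ne_zero)
      have : 0 < |ρ ^ 2 - 0 ^ 2| := abs_pos.2 (by have := pow_pos hρ 2; simp only [zero_pow two_ne_zero, sub_zero]; exact this.ne')
      linarith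
  rw [intervalIntegral.integral_const_mul]
  have h2 := mul_lt_mul_of_pos_left this (by positivity : 0 < 2 * μ)
  calc _ = 2 * μ * ∫ t in (0 : ℝ)..ρ, angleWeight (μ * t) / (1 + |ρ ^ 2 - t ^ 2|) ^ 2 := by
        field_simp
    _ < _ := h2

/-- Equality holds at `a = b = 2/3`. With `a = 1 - u₀` and `b = 1 - u` this is the energy form of
the tangent-line bound `1 / (1 - u)² ≥ 27 u / 4`, sharp at `u = 1/3`. -/
theorem mul_mul_two_sub_le {a b : ℝ} (ha : 0 ≤ a) (hb : 0 ≤ b) :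
    a * b * (2 - a - b) ≤ 8 / 27 := by
  rcases le_total (a + b) 2 with h | h
  · have h1 : a * b * (2 - a - b) ≤ ((a + b) / 2) ^ 2 * (2 - a - b) :=
      mul_le_mul_of_nonneg_right (by nlinarith [sq_nonneg (a - b)]) (by linarith)
    have h2 : 0 ≤ (3 * (a + b) - 4) ^ 2 * (3 * (a + b) + 2) := by positivity
    nlinarith
  · have : a * b * (2 - a - b) ≤ 0 := mul_nonpos_of_nonneg_of_nonpos (by positivity) (by linarith)
    linarith

/-- The time map of the semilinear problem is at most the one of its linear minorant. -/
theorem integral_inv_sq_le {ρ : ℝ} (hρ : 0 < ρ) :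
    Real.sqrt (27 / 2) * ∫ t in (0 : ℝ)..ρ, 1 / (1 + |ρ ^ 2 - t ^ 2|) ^ 2 ≤ Real.pi / 2 := by
  have hb : ∀ t ∈ Set.Icc 0 ρ, 0 ≤ ρ ^ 2 - t ^ 2 := fun t ht => by nlinarith [ht.1, ht.2]
  have hcont : Continuous fun t : ℝ => Real.sqrt (27 / 2) * (1 / (1 + |ρ ^ 2 - t ^ 2|) ^ 2) := by
    refine continuous_const.mul (Continuous.div continuous_const (by fun_prop) fun x => ?_)
    positivity
  rw [← intervalIntegral.integral_const_mul]
  -- The comparison primitive is `-arcsin (u / u₀)`, with `u₀` the maximum: the time map of the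
  -- linear problem. At `t = 0` the arcsine is singular, so only continuity is used there and
  -- derivatives only in the interior.
  have hkey := intervalIntegral.integral_le_sub_of_hasDeriv_right_of_le hρ.le
    (g := fun t => -Real.arcsin ((1 - 1 / (1 + (ρ ^ 2 - t ^ 2))) / (1 - 1 / (1 + ρ ^ 2))))
    (g' := fun t => 2 * t / (1 + (ρ ^ 2 - t ^ 2)) ^ 2
      / Real.sqrt ((1 - 1 / (1 + ρ ^ 2)) ^ 2 - (1 - 1 / (1 + (ρ ^ 2 - t ^ 2))) ^ 2))
    (φ := fun t => Real.sqrt (27 / 2) * (1 / (1 + |ρ ^ 2 - t ^ 2|) ^ 2)) ?_ ?_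
    hcont.continuousOn.integrableOn_Icc ?_
  · refine hkey.trans ?_
    simp only [sub_self, add_zero, div_one, zero_div, Real.arcsin_zero, neg_zero, zero_sub, neg_neg]
    exact Real.arcsin_le_pi_div_two _
  · refine (Real.continuous_arcsin.comp_continuousOn
      (ContinuousOn.div_const (ContinuousOn.sub continuousOn_const
        (ContinuousOn.div continuousOn_const (by fun_prop) fun t ht => ?_)) _)).neg
    have := hb t ht
    positivity
  all_goals
    intro t ht
    have hbt := hb t ⟨ht.1.le, ht.2.le⟩
    have ht0 := ht.1
    obtain ⟨A, hA⟩ : ∃ A, A = 1 / (1 + ρ ^ 2) := ⟨_, rfl⟩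
    obtain ⟨q, hq⟩ : ∃ q, q = 1 + (ρ ^ 2 - t ^ 2) := ⟨_, rfl⟩
    have hq0 : 0 < q := by linarith
    have hq1 : q < 1 + ρ ^ 2 := by nlinarith
    have hA0 : 0 < A := by rw [hA]; positivity
    have hAB : A < 1 / q := by rw [hA]; exact one_div_lt_one_div_of_lt hq0 hq1
    have hB1 : 1 / q < 1 := by
      rw [div_lt_one hq0, hq]
      nlinarith [ht.2]
    have hdiff : (1 - A) ^ 2 - (1 - 1 / q) ^ 2 = (1 / q - A) * (2 - A - 1 / q) := by ring
    have hdpos : 0 < (1 - A) ^ 2 - (1 - 1 / q) ^ 2 := by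
      rw [hdiff]; exact mul_pos (by linarith) (by linarith)
  · have hA1 : 0 < 1 - A := by linarith
    have hu : HasDerivAt (fun t : ℝ => (1 - 1 / (1 + (ρ ^ 2 - t ^ 2))) / (1 - 1 / (1 + ρ ^ 2)))
        (-(2 * t / q ^ 2) / (1 - A)) t := by
      have h1 : HasDerivAt (fun t : ℝ => 1 + (ρ ^ 2 - t ^ 2)) (-(2 * t)) t := by
        simpa using ((hasDerivAt_pow 2 t).const_sub (ρ ^ 2)).const_add 1
      have := (((hasDerivAt_const t (1 : ℝ)).div h1 (by rw [← hq]; exact hq0.ne')).const_sub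
        1).div_const (1 - 1 / (1 + ρ ^ 2))
      refine this.congr_deriv ?_
      rw [← hA, ← hq]; ring
    have hlt : (1 - 1 / q) / (1 - A) < 1 := by rw [div_lt_one hA1]; linarith
    have hgt : -1 < (1 - 1 / q) / (1 - A) :=
      lt_of_lt_of_le (by norm_num) (div_nonneg (by linarith) hA1.le)
    have hd := (Real.hasDerivAt_arcsin (x := (1 - 1 / q) / (1 - A)) hgt.ne' hlt.ne)
    rw [hA, hq] at hd
    have := (hd.comp t hu).neg.hasDerivWithinAt (s := Set.Ioi t)
    refine this.congr_deriv ?_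
    rw [← hA, ← hq]
    have hs : Real.sqrt (1 - ((1 - 1 / q) / (1 - A)) ^ 2)
        = Real.sqrt ((1 - A) ^ 2 - (1 - 1 / q) ^ 2) / (1 - A) := by
      rw [show 1 - ((1 - 1 / q) / (1 - A)) ^ 2
        = ((1 - A) ^ 2 - (1 - 1 / q) ^ 2) / (1 - A) ^ 2 by field_simp]
      rw [Real.sqrt_div hdpos.le, Real.sqrt_sq hA1.le]
    rw [hs]
    have := Real.sqrt_pos.2 hdpos
    field_simp
  · rw [abs_of_nonneg hbt, ← hA, ← hq]
    have hs : Real.sqrt ((1 - A) ^ 2 - (1 - 1 / q) ^ 2) ≤ Real.sqrt (8 / 27) * t := by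
      rw [show Real.sqrt (8 / 27) * t = Real.sqrt (8 / 27 * t ^ 2) by
        rw [Real.sqrt_mul (by norm_num), Real.sqrt_sq ht0.le]]
      refine Real.sqrt_le_sqrt ?_
      have ht2 : t ^ 2 * (A * (1 / q)) = 1 / q - A := by
        rw [hA]
        have : t ^ 2 = 1 + ρ ^ 2 - q := by rw [hq]; ring
        rw [this]; field_simp
      have := mul_mul_two_sub_le hA0.le (by positivity : 0 ≤ 1 / q)
      rw [hdiff, ← ht2]
      nlinarith [mul_le_mul_of_nonneg_left this (sq_nonneg t)]
    rw [le_div_iff₀ (Real.sqrt_pos.2 hdpos)]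
    have hprod : Real.sqrt (27 / 2) * Real.sqrt (8 / 27) = 2 := by
      rw [← Real.sqrt_mul (by norm_num), show (27 / 2 : ℝ) * (8 / 27) = 2 ^ 2 by norm_num]
      exact Real.sqrt_sq (by norm_num)
    calc Real.sqrt (27 / 2) * (1 / q ^ 2) * Real.sqrt ((1 - A) ^ 2 - (1 - 1 / q) ^ 2)
        ≤ Real.sqrt (27 / 2) * (1 / q ^ 2) * (Real.sqrt (8 / 27) * t) := by gcongr
      _ = (Real.sqrt (27 / 2) * Real.sqrt (8 / 27)) * t / q ^ 2 := by ring
      _ = 2 * t / q ^ 2 := by rw [hprod]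

/-- The weight lies below its value `1 / √2` at `0`, which leaves the integral of the semilinear
problem; with `I` that integral, `(μ T)² < 2 I² ≤ π² / 27`. -/
theorem sq_mul_timeMap_sq_lt {μ ρ : ℝ} (hμ : 0 < μ) (hρ : 0 < ρ) (h : μ * ρ ≤ 1) :
    μ ^ 2 * timeMap μ ρ ^ 2 < Real.pi ^ 2 / 27 := by
  have hcont : Continuous fun t : ℝ => 1 / Real.sqrt 2 * (1 / (1 + |ρ ^ 2 - t ^ 2|) ^ 2) := by
    refine continuous_const.mul (Continuous.div continuous_const (by fun_prop) fun x => ?_)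
    positivity
  have hGle : ∀ t ∈ Set.Ioc 0 ρ, angleWeight (μ * t) < 1 / Real.sqrt 2 := fun t ht => by
    rw [← angleWeight_zero]
    have h1 : μ * t ≤ 1 := (mul_le_mul_of_nonneg_left ht.2 hμ.le).trans h
    have h0 : 0 < μ * t := mul_pos hμ ht.1
    exact strictAntiOn_angleWeight ⟨le_rfl, zero_le_one⟩ ⟨h0.le, h1⟩ h0
  have hlt : ∫ t in (0 : ℝ)..ρ, angleWeight (μ * t) / (1 + |ρ ^ 2 - t ^ 2|) ^ 2
      < ∫ t in (0 : ℝ)..ρ, 1 / Real.sqrt 2 * (1 / (1 + |ρ ^ 2 - t ^ 2|) ^ 2) := by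
    have hl : ∀ t ∈ Set.Ioc 0 ρ, angleWeight (μ * t) / (1 + |ρ ^ 2 - t ^ 2|) ^ 2
        < 1 / Real.sqrt 2 * (1 / (1 + |ρ ^ 2 - t ^ 2|) ^ 2) := fun t ht => by
      rw [mul_one_div]
      exact div_lt_div_of_pos_right (hGle t ht) (by positivity)
    exact intervalIntegral.integral_lt_integral_of_continuousOn_of_le_of_exists_lt hρ
      (continuous_profile_integrand μ ρ).continuousOn hcont.continuousOn
      (fun t ht => (hl t ht).le) ⟨ρ, ⟨hρ.le, le_rfl⟩, hl ρ ⟨hρ, le_rfl⟩⟩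
  rw [intervalIntegral.integral_const_mul] at hlt
  have hle := integral_inv_sq_le hρ
  have hpos := timeMap_pos hμ hρ h
  have hT : μ * timeMap μ ρ
      = 2 * ∫ t in (0 : ℝ)..ρ, angleWeight (μ * t) / (1 + |ρ ^ 2 - t ^ 2|) ^ 2 := by
    rw [timeMap, profileX]; field_simp
  set I := ∫ t in (0 : ℝ)..ρ, 1 / (1 + |ρ ^ 2 - t ^ 2|) ^ 2
  set J := ∫ t in (0 : ℝ)..ρ, angleWeight (μ * t) / (1 + |ρ ^ 2 - t ^ 2|) ^ 2
  have hJ : 0 < J := by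
    have : 0 < μ * timeMap μ ρ := mul_pos hμ hpos
    rw [hT] at this; linarith
  have h2 : Real.sqrt 2 ^ 2 = 2 := Real.sq_sqrt (by norm_num)
  have h27 : Real.sqrt (27 / 2) ^ 2 = 27 / 2 := Real.sq_sqrt (by norm_num)
  have hI : 0 < I := by
    by_contra hI
    have : 1 / Real.sqrt 2 * I ≤ 0 := mul_nonpos_of_nonneg_of_nonpos (by positivity) (not_lt.1 hI)
    linarith
  have hJ2 : J ^ 2 < I ^ 2 / 2 := by
    have := pow_lt_pow_left₀ hlt hJ.le two_ne_zero
    rwa [mul_pow, div_pow, h2, one_pow, one_div, inv_mul_eq_div] at this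
  have hI2 : 27 / 2 * I ^ 2 ≤ Real.pi ^ 2 / 4 := by
    have := pow_le_pow_left₀ (by positivity) hle 2
    rw [mul_pow, h27, div_pow] at this
    linarith
  rw [← mul_pow, hT, mul_pow]
  linarith

/-! ### The critical parameter. -/

/-- Take the largest `μ` for which some `ρ` reaches level `L`. If its peak exceeded `L`, the strict
inequality `μ r < 1` would leave room to increase `μ`. -/
theorem exists_critical_parameter {L : ℝ} (hL : 0 < L) :
    ∃ μ, 0 < μ ∧ (∃ r, 0 < r ∧ μ * r ≤ 1 ∧ timeMap μ r = L) ∧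
      ∀ ρ, 0 < ρ → μ * ρ ≤ 1 → timeMap μ ρ ≤ L := by
  have hT1 : 0 < timeMap 1 1 := timeMap_pos one_pos one_pos (by norm_num)
  have hiff : ∀ μ ρ : ℝ, 0 < μ →
      (L ≤ timeMap μ ρ ↔ L * μ ≤ 2 * ∫ z in (0 : ℝ)..1, timeKernel μ ρ z) := by
    intro μ ρ hμ
    rw [timeMap_eq_integral, div_mul_eq_mul_div, le_div_iff₀ hμ]
  -- Chosen so that `(ε, 1)` is admissible: lowering `μ` from `1` to `ε` multiplies the time map at
  -- `ρ = 1` by at least `1 / ε`.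
  obtain ⟨ε, hε⟩ : ∃ ε, ε = min 1 (timeMap 1 1 / L) := ⟨_, rfl⟩
  have hε0 : 0 < ε := by rw [hε]; positivity
  have hε1 : ε ≤ 1 := hε ▸ min_le_left _ _
  have hεL : ε * L ≤ timeMap 1 1 := by
    rw [← le_div_iff₀ hL]; exact hε ▸ min_le_right _ _
  have hbound : ∀ μ ρ : ℝ, 0 < μ → 0 < ρ → μ * ρ ≤ 1 → L ≤ timeMap μ ρ → μ ≤ 1 / L + 1 := by
    intro μ ρ hμ hρ h hle
    have h1 := sq_mul_timeMap_lt_one hμ hρ h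
    by_contra hcon
    have h2 : 1 / L + 1 < μ := not_le.1 hcon
    have h3 : 1 / L * L = 1 := by field_simp
    have h4 : 0 < 1 / L := by positivity
    have h5 : 1 < μ * L := by nlinarith
    have h6 : 1 < μ := by linarith
    nlinarith [mul_le_mul_of_nonneg_left hle (sq_nonneg μ)]
  -- The cut `ρ ≤ 1` loses nothing, since peaks lie in `(0, 1]`. The level condition is multiplied
  -- by `μ` to be a closed condition between functions continuous everywhere.
  set K : Set (ℝ × ℝ) := (Set.Icc ε (1 / L + 1) ×ˢ Set.Icc 0 1) ∩
    ({p | p.1 * p.2 ≤ 1} ∩ {p | L * p.1 ≤ 2 * ∫ z in (0 : ℝ)..1, timeKernel p.1 p.2 z}) with hK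
  have hKc : IsCompact K := by
    refine (isCompact_Icc.prod isCompact_Icc).inter_right (IsClosed.inter ?_ ?_)
    · exact isClosed_le (by fun_prop) continuous_const
    · exact isClosed_le (by fun_prop) (continuous_const.mul continuous_integral_timeKernel)
  have hmem : (ε, (1 : ℝ)) ∈ K := by
    have hle : L ≤ timeMap ε 1 := by
      rw [hiff ε 1 hε0]
      have h1 := integral_timeKernel_anti hε0 hε1 zero_le_one (by norm_num)
      rw [timeMap_eq_integral] at hεL
      linarith
    exact ⟨⟨⟨le_rfl, hbound ε 1 hε0 one_pos (by linarith) hle⟩, ⟨zero_le_one, le_rfl⟩⟩,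
      ⟨by simpa using hε1, (hiff ε 1 hε0).1 hle⟩⟩
  obtain ⟨⟨μ, ρ⟩, hp, hmax⟩ := hKc.exists_isMaxOn ⟨_, hmem⟩ continuous_fst.continuousOn
  obtain ⟨⟨⟨hμε, -⟩, ⟨hρ0, hρ1⟩⟩, hμρ, hLμ⟩ := hp
  simp only [Set.mem_ofPred_eq] at hμε hρ0 hρ1 hμρ hLμ
  have hμ : 0 < μ := hε0.trans_le hμε
  have hLT := (hiff μ ρ hμ).2 hLμ
  obtain ⟨r, hr0, hr1, hrμ, hmono, hanti⟩ := exists_timeMap_peak hμ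
  have hpeak : ∀ ρ, 0 ≤ ρ → μ * ρ ≤ 1 → timeMap μ ρ ≤ timeMap μ r := by
    intro ρ h0 h1
    have h2 : ρ ≤ 1 / μ := by rwa [le_div_iff₀ hμ, mul_comm]
    rcases le_total ρ r with h | h
    · exact hmono.monotoneOn ⟨h0, h⟩ ⟨hr0.le, le_rfl⟩ h
    · exact hanti.antitoneOn ⟨le_rfl, hrμ.le⟩ ⟨h, h2⟩ h
  have hμr : μ * r < 1 := by rwa [lt_div_iff₀ hμ, mul_comm] at hrμ
  have hle : timeMap μ r ≤ L := by
    by_contra hcon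
    have hlt : L * μ < 2 * ∫ z in (0 : ℝ)..1, timeKernel μ r z := by
      have h1 := not_le.1 hcon
      rwa [timeMap_eq_integral, div_mul_eq_mul_div, lt_div_iff₀ hμ] at h1
    have hc : Continuous fun m : ℝ => ∫ z in (0 : ℝ)..1, timeKernel m r z :=
      continuous_integral_timeKernel.comp (by fun_prop : Continuous fun m : ℝ => (m, r))
    have hev1 : ∀ᶠ m in nhds μ, L * m < 2 * ∫ z in (0 : ℝ)..1, timeKernel m r z :=
      (continuous_const.mul continuous_id).continuousAt.eventually_lt
        (continuous_const.mul hc).continuousAt hlt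
    have hev2 : ∀ᶠ m in nhds μ, m * r < 1 :=
      (continuous_id.mul continuous_const).continuousAt.eventually_lt continuousAt_const hμr
    have h3 : ∀ᶠ m in nhdsWithin μ (Set.Ioi μ), μ < m := self_mem_nhdsWithin
    obtain ⟨m, ⟨hm1, hm2⟩, hm3⟩ :=
      (((hev1.and hev2).filter_mono nhdsWithin_le_nhds).and h3).exists
    have hm0 := hμ.trans hm3
    have hmK : (m, r) ∈ K :=
      ⟨⟨⟨hμε.trans hm3.le, hbound m r hm0 hr0 hm2.le ((hiff m r hm0).2 hm1.le)⟩,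
        ⟨hr0.le, hr1⟩⟩, ⟨hm2.le, hm1.le⟩⟩
    have h4 : m ≤ μ := hmax hmK
    linarith
  exact ⟨μ, hμ, ⟨r, hr0, hμr.le, le_antisymm hle (hLT.trans (hpeak ρ hρ0 hμρ))⟩,
    fun ρ h0 h1 => (hpeak ρ h0.le h1).trans hle⟩

/-! ### The endpoint value of the time map is `gFun`. -/

/-- The integral form of `gFun`. -/
noncomputable def gIntegral (l : ℝ) : ℝ :=
  l / (1 + l) * ∫ w in (0 : ℝ)..1, (1 + w ^ 2) / ((1 + l) - (1 - l) * w ^ 2)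

theorem gIntegral_denom_pos {l w : ℝ} (hl : 0 < l) (hw : w ∈ Set.Icc (0 : ℝ) 1) :
    0 < (1 + l) - (1 - l) * w ^ 2 := by
  have : w ^ 2 ≤ 1 := by nlinarith [hw.1, hw.2]
  nlinarith [sq_nonneg w]

theorem intervalIntegrable_gIntegral {l : ℝ} (hl : 0 < l) :
    IntervalIntegrable (fun w : ℝ => (1 + w ^ 2) / ((1 + l) - (1 - l) * w ^ 2))
      MeasureTheory.volume 0 1 := by
  refine ContinuousOn.intervalIntegrable (ContinuousOn.div (by fun_prop) (by fun_prop) fun w hw => ?_)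
  rw [Set.uIcc_of_le zero_le_one] at hw
  exact (gIntegral_denom_pos hl hw).ne'

theorem gIntegral_eq_of_lt_one {l : ℝ} (hl : 0 < l) (h1 : l < 1) :
    gIntegral l = l / (1 - l ^ 2) ^ (3 / 2 : ℝ)
      * (Real.log ((1 + Real.sqrt (1 - l ^ 2)) / l) - Real.sqrt (1 - l ^ 2)) := by
  obtain ⟨a, ha⟩ : ∃ a, a = Real.sqrt (1 + l) := ⟨_, rfl⟩
  obtain ⟨b, hb⟩ : ∃ b, b = Real.sqrt (1 - l) := ⟨_, rfl⟩
  have ha2 : a ^ 2 = 1 + l := by rw [ha]; exact Real.sq_sqrt (by linarith)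
  have hb2 : b ^ 2 = 1 - l := by rw [hb]; exact Real.sq_sqrt (by linarith)
  have ha0 : 0 < a := by rw [ha]; exact Real.sqrt_pos.2 (by linarith)
  have hb0 : 0 < b := by rw [hb]; exact Real.sqrt_pos.2 (by linarith)
  have hba : b < a := by nlinarith
  have hab : Real.sqrt (1 - l ^ 2) = a * b := by
    rw [ha, hb, ← Real.sqrt_mul (by linarith)]; congr 1; ring
  have hpow : (1 - l ^ 2) ^ (3 / 2 : ℝ) = (a * b) ^ 3 := by
    rw [← hab, Real.rpow_div_two_eq_sqrt 3 (by nlinarith)]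
    exact_mod_cast Real.rpow_natCast _ 3
  have hint : ∫ w in (0 : ℝ)..1, (1 + w ^ 2) / ((1 + l) - (1 - l) * w ^ 2)
      = -1 / b ^ 2 + 1 / (a * b ^ 3) * Real.log ((a + b) / (a - b)) := by
    have hpos : ∀ w ∈ Set.uIcc (0 : ℝ) 1, 0 < a + b * w ∧ 0 < a - b * w := by
      intro w hw
      rw [Set.uIcc_of_le zero_le_one] at hw
      have := mul_nonneg hb0.le hw.1
      constructor <;> nlinarith [hw.2]
    rw [intervalIntegral.integral_eq_sub_of_hasDerivAt (f := fun w : ℝ =>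
      -w / b ^ 2 + 1 / (a * b ^ 3) * (Real.log (a + b * w) - Real.log (a - b * w))) ?_
      (intervalIntegrable_gIntegral hl)]
    · rw [Real.log_div (by positivity) (by linarith)]
      simp
    · intro w hw
      obtain ⟨h3, h4⟩ := hpos w hw
      have hlin : HasDerivAt (fun w : ℝ => b * w) b w := by
        simpa using (hasDerivAt_id w).const_mul b
      have := ((hasDerivAt_id w).neg.div_const (b ^ 2)).add
        ((((hlin.const_add a).log h3.ne').sub ((hlin.const_sub a).log h4.ne')).const_mul
          (1 / (a * b ^ 3)))
      refine this.congr_deriv ?_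
      rw [← ha2, ← hb2, show a ^ 2 - b ^ 2 * w ^ 2 = (a + b * w) * (a - b * w) by ring]
      have h3' := h3.ne'
      have h4' := h4.ne'
      have hsum : a ^ 2 + b ^ 2 = 2 := by linarith
      field_simp
      ring_nf
      linear_combination (-a) * hsum
  -- Rests on `a² + b² = 2` and `a² - b² = 2 l`.
  have hlogarg : (1 + Real.sqrt (1 - l ^ 2)) / l = (a + b) / (a - b) := by
    rw [hab, div_eq_div_iff hl.ne' (by linarith)]
    have hl' : l = (a ^ 2 - b ^ 2) / 2 := by linarith
    have hsum : a ^ 2 + b ^ 2 = 2 := by linarith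
    rw [hl']
    linear_combination (-(a - b) / 2) * hsum
  rw [gIntegral, hint, hpow, hlogarg, hab, ← ha2]
  field_simp
  ring

theorem gIntegral_one : gIntegral 1 = 1 / 3 := by
  rw [gIntegral]
  norm_num

theorem gIntegral_eq_of_one_lt {l : ℝ} (h1 : 1 < l) :
    gIntegral l = l / (l ^ 2 - 1) ^ (3 / 2 : ℝ)
      * (Real.sqrt (l ^ 2 - 1) - Real.arccos (1 / l)) := by
  have hl : 0 < l := by linarith
  obtain ⟨a, ha⟩ : ∃ a, a = Real.sqrt (l + 1) := ⟨_, rfl⟩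
  obtain ⟨b, hb⟩ : ∃ b, b = Real.sqrt (l - 1) := ⟨_, rfl⟩
  have ha2 : a ^ 2 = l + 1 := by rw [ha]; exact Real.sq_sqrt (by linarith)
  have hb2 : b ^ 2 = l - 1 := by rw [hb]; exact Real.sq_sqrt (by linarith)
  have ha0 : 0 < a := by rw [ha]; exact Real.sqrt_pos.2 (by linarith)
  have hb0 : 0 < b := by rw [hb]; exact Real.sqrt_pos.2 (by linarith)
  have hab : Real.sqrt (l ^ 2 - 1) = a * b := by
    rw [ha, hb, ← Real.sqrt_mul (by linarith)]; congr 1; ring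
  have hpow : (l ^ 2 - 1) ^ (3 / 2 : ℝ) = (a * b) ^ 3 := by
    rw [← hab, Real.rpow_div_two_eq_sqrt 3 (by nlinarith)]
    exact_mod_cast Real.rpow_natCast _ 3
  have hsub : a ^ 2 - b ^ 2 = 2 := by linarith
  have hint : ∫ w in (0 : ℝ)..1, (1 + w ^ 2) / ((1 + l) - (1 - l) * w ^ 2)
      = 1 / b ^ 2 - 2 / (a * b ^ 3) * Real.arctan (b / a) := by
    rw [intervalIntegral.integral_eq_sub_of_hasDerivAt (f := fun w : ℝ =>
      w / b ^ 2 - 2 / (a * b ^ 3) * Real.arctan (b / a * w)) ?_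
      (intervalIntegrable_gIntegral hl)]
    · simp
    · intro w hw
      have hlin : HasDerivAt (fun w : ℝ => b / a * w) (b / a) w := by
        simpa using (hasDerivAt_id w).const_mul (b / a)
      have := ((hasDerivAt_id w).div_const (b ^ 2)).sub
        (hlin.arctan.const_mul (2 / (a * b ^ 3)))
      refine this.congr_deriv ?_
      rw [show (1 + l) - (1 - l) * w ^ 2 = a ^ 2 + b ^ 2 * w ^ 2 by rw [ha2, hb2]; ring]
      have h5 : 0 < a ^ 2 + b ^ 2 * w ^ 2 := by positivity
      have h6 : (1 + (b / a * w) ^ 2) = (a ^ 2 + b ^ 2 * w ^ 2) / a ^ 2 := by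
        field_simp
      rw [h6]
      field_simp
      linear_combination hsub
  -- Half-angle formula: `cos (2 arctan (b / a)) = (a² - b²) / (a² + b²) = 1 / l`.
  have harc : Real.arccos (1 / l) = 2 * Real.arctan (b / a) := by
    have h0 : 0 ≤ Real.arctan (b / a) := Real.arctan_nonneg.2 (by positivity)
    have hlt : Real.arctan (b / a) < Real.pi / 2 := Real.arctan_lt_pi_div_two _
    rw [← Real.arccos_cos (x := 2 * Real.arctan (b / a)) (by linarith) (by linarith)]
    congr 1
    rw [Real.cos_two_mul, Real.cos_sq_arctan, div_pow, ha2, hb2]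
    have : l + 1 ≠ 0 := by positivity
    field_simp
    rw [show l + 1 + (l - 1) = 2 * l by ring]
    field_simp
    ring
  rw [gIntegral, hint, hpow, hab, harc, add_comm 1 l, ← ha2]
  field_simp

theorem gFun_eq_gIntegral {l : ℝ} (hl : 0 < l) : gFun l = gIntegral l := by
  rw [gFun]
  split_ifs with h1 h2
  · exact (gIntegral_eq_of_lt_one hl h1).symm
  · rw [h2, gIntegral_one]
  · exact (gIntegral_eq_of_one_lt (lt_of_le_of_ne (not_lt.1 h1) (Ne.symm h2))).symm

/-- The two integrands differ by the derivative of a multiple of `w (1 - w²) / ((1 + l) - (1 - l)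
w²)`, which vanishes at `w = 0` and `w = 1`. -/
theorem integral_sub_by_parts {l : ℝ} (hl : 0 < l) :
    ∫ w in (0 : ℝ)..1, 2 * l * (1 - w ^ 2) / ((1 + l) - (1 - l) * w ^ 2) ^ 2 = gIntegral l := by
  have hne : ∀ w ∈ Set.uIcc (0 : ℝ) 1, (1 + l) - (1 - l) * w ^ 2 ≠ 0 := fun w hw => by
    rw [Set.uIcc_of_le zero_le_one] at hw
    exact (gIntegral_denom_pos hl hw).ne'
  have hi1 : IntervalIntegrable (fun w : ℝ => 2 * l * (1 - w ^ 2) / ((1 + l) - (1 - l) * w ^ 2) ^ 2)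
      MeasureTheory.volume 0 1 :=
    ContinuousOn.intervalIntegrable (ContinuousOn.div (by fun_prop) (by fun_prop)
      fun w hw => pow_ne_zero 2 (hne w hw))
  have hi2 := (intervalIntegrable_gIntegral hl).const_mul (l / (1 + l))
  rw [gIntegral, ← intervalIntegral.integral_const_mul, ← sub_eq_zero,
    ← intervalIntegral.integral_sub hi1 hi2]
  rw [intervalIntegral.integral_eq_sub_of_hasDerivAt (f := fun w : ℝ =>
    l / (1 + l) * (w * (1 - w ^ 2) / ((1 + l) - (1 - l) * w ^ 2))) ?_ (hi1.sub hi2)]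
  · simp
  · intro w hw
    have hn : HasDerivAt (fun w : ℝ => w * (1 - w ^ 2)) (1 - 3 * w ^ 2) w := by
      refine ((hasDerivAt_id w).mul ((hasDerivAt_pow 2 w).const_sub 1)).congr_deriv ?_
      simp; ring
    have hd : HasDerivAt (fun w : ℝ => (1 + l) - (1 - l) * w ^ 2) (-((1 - l) * (2 * w))) w := by
      simpa using ((hasDerivAt_pow 2 w).const_mul (1 - l)).const_sub (1 + l)
    refine ((hn.div hd (hne w hw)).const_mul (l / (1 + l))).congr_deriv ?_
    have := hne w hw
    have h2 : 1 + l ≠ 0 := by positivity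
    field_simp
    ring

theorem timeMap_endpoint {μ : ℝ} (hμ : 0 < μ) : timeMap μ (1 / μ) = gIntegral (μ ^ 2) := by
  have hl : 0 < μ ^ 2 := by positivity
  have hstep : timeMap μ (1 / μ) = ∫ x in (0 : ℝ)..1,
      2 * μ ^ 2 * angleWeight x / (μ ^ 2 + |1 - x ^ 2|) ^ 2 := by
    rw [timeMap_eq_integral, ← intervalIntegral.integral_const_mul]
    refine intervalIntegral.integral_congr fun x _ => ?_
    have h1 : μ * (1 / μ) * x = x := by field_simp
    have h2 : 1 + (1 / μ) ^ 2 * |1 - x ^ 2| = (μ ^ 2 + |1 - x ^ 2|) / μ ^ 2 := by field_simp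
    have h3 : 0 < μ ^ 2 + |1 - x ^ 2| := by positivity
    simp only [timeKernel, h1, h2]
    field_simp
  have hcont : Continuous fun x : ℝ => 2 * μ ^ 2 * angleWeight x / (μ ^ 2 + |1 - x ^ 2|) ^ 2 := by
    refine Continuous.div (continuous_const.mul continuous_angleWeight) (by fun_prop) fun x => ?_
    positivity
  -- The substitution `w = tan (θ / 2)`, where `x = √2 sin (θ / 2)`, makes the integrand rational.
  have hsubst := intervalIntegral.integral_comp_mul_deriv (a := 0) (b := 1)
    (f := fun w : ℝ => Real.sqrt 2 * w / Real.sqrt (1 + w ^ 2))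
    (f' := fun w : ℝ => Real.sqrt 2 / Real.sqrt (1 + w ^ 2) ^ 3)
    (g := fun x : ℝ => 2 * μ ^ 2 * angleWeight x / (μ ^ 2 + |1 - x ^ 2|) ^ 2) ?_ ?_ hcont
  · simp only [mul_zero, zero_div, mul_one] at hsubst
    rw [show Real.sqrt 2 / Real.sqrt (1 + 1 ^ 2) = 1 by
      rw [show (1 : ℝ) + 1 ^ 2 = 2 by norm_num]; exact div_self (by positivity)] at hsubst
    rw [hstep, ← hsubst, ← integral_sub_by_parts hl]
    refine intervalIntegral.integral_congr fun w hw => ?_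
    rw [Set.uIcc_of_le zero_le_one] at hw
    have hw2 : w ^ 2 ≤ 1 := by nlinarith [hw.1, hw.2]
    have hp : 0 < 1 + w ^ 2 := by positivity
    have hR0 : 0 < Real.sqrt (1 + w ^ 2) := Real.sqrt_pos.2 hp
    have hR2 : Real.sqrt (1 + w ^ 2) ^ 2 = 1 + w ^ 2 := Real.sq_sqrt hp.le
    have h22 : Real.sqrt 2 ^ 2 = 2 := Real.sq_sqrt (by norm_num)
    have h20 : 0 < Real.sqrt 2 := by positivity
    have hx2 : (Real.sqrt 2 * w / Real.sqrt (1 + w ^ 2)) ^ 2 = 2 * w ^ 2 / (1 + w ^ 2) := by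
      rw [div_pow, mul_pow, h22, hR2]
    have hxle : (Real.sqrt 2 * w / Real.sqrt (1 + w ^ 2)) ^ 2 ≤ 1 := by
      rw [hx2, div_le_one hp]; linarith
    have hG : angleWeight (Real.sqrt 2 * w / Real.sqrt (1 + w ^ 2))
        = (1 - w ^ 2) / (1 + w ^ 2) * (Real.sqrt (1 + w ^ 2) / Real.sqrt 2) := by
      rw [angleWeight_eq hxle, hx2,
        show 2 - 2 * w ^ 2 / (1 + w ^ 2) = 2 / (1 + w ^ 2) by field_simp; ring,
        Real.sqrt_div (by norm_num)]
      field_simp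
      ring
    have habs : μ ^ 2 + |1 - (Real.sqrt 2 * w / Real.sqrt (1 + w ^ 2)) ^ 2|
        = ((1 + μ ^ 2) - (1 - μ ^ 2) * w ^ 2) / (1 + w ^ 2) := by
      rw [abs_of_nonneg (by linarith), hx2]
      field_simp
      ring
    have hE := gIntegral_denom_pos hl hw
    simp only [Function.comp, habs, hG]
    set R := Real.sqrt (1 + w ^ 2) with hRdef
    rw [← hR2]
    field_simp
  · intro w _
    have hp : 0 < 1 + w ^ 2 := by positivity
    have hR0 : 0 < Real.sqrt (1 + w ^ 2) := Real.sqrt_pos.2 hp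
    have hR2 : Real.sqrt (1 + w ^ 2) ^ 2 = 1 + w ^ 2 := Real.sq_sqrt hp.le
    have hq : HasDerivAt (fun w : ℝ => 1 + w ^ 2) (2 * w) w := by
      simpa using (hasDerivAt_pow 2 w).const_add 1
    refine (((hasDerivAt_id w).const_mul (Real.sqrt 2)).div (hq.sqrt hp.ne') hR0.ne').congr_deriv ?_
    simp only [id]
    field_simp
    rw [hR2]; ring
  · refine ContinuousOn.div continuousOn_const (by fun_prop) fun w _ => ?_
    have hp : 0 < 1 + w ^ 2 := by positivity
    positivity

/-! ### Quasiconcavity, limits and level sets of `gFun`. -/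

/-- The integrand is concave in `e` for each `w`: the concavity gap, computed in closed form in
`hid`, is nonnegative and carries the factor `1 - w⁴`. -/
theorem strictConcaveOn_gIntegral_param :
    StrictConcaveOn ℝ (Set.Ioo (-1 : ℝ) 1)
      (fun e => ∫ w in (0 : ℝ)..1, (1 - e ^ 2) * (1 + w ^ 2) / (4 * (1 - e * w ^ 2))) := by
  have hpos : ∀ e ∈ Set.Ioo (-1 : ℝ) 1, ∀ w ∈ Set.Icc (0 : ℝ) 1, 0 < 1 - e * w ^ 2 := by
    intro e he w hw
    have : w ^ 2 ≤ 1 := by nlinarith [hw.1, hw.2]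
    nlinarith [he.1, he.2, sq_nonneg w]
  have hc : ∀ e ∈ Set.Ioo (-1 : ℝ) 1, ContinuousOn
      (fun w : ℝ => (1 - e ^ 2) * (1 + w ^ 2) / (4 * (1 - e * w ^ 2))) (Set.Icc 0 1) :=
    fun e he => ContinuousOn.div (by fun_prop) (by fun_prop)
      fun w hw => mul_ne_zero four_ne_zero (hpos e he w hw).ne'
  have hi : ∀ e ∈ Set.Ioo (-1 : ℝ) 1, IntervalIntegrable
      (fun w : ℝ => (1 - e ^ 2) * (1 + w ^ 2) / (4 * (1 - e * w ^ 2))) MeasureTheory.volume 0 1 :=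
    fun e he => ContinuousOn.intervalIntegrable (by
      rw [Set.uIcc_of_le zero_le_one]; exact hc e he)
  refine ⟨convex_Ioo _ _, fun x hx y hy hxy a b ha hb hab => ?_⟩
  have hm : a * x + b * y ∈ Set.Ioo (-1 : ℝ) 1 := convex_Ioo (-1 : ℝ) 1 hx hy ha.le hb.le hab
  simp only [smul_eq_mul]
  rw [← intervalIntegral.integral_const_mul, ← intervalIntegral.integral_const_mul,
    ← intervalIntegral.integral_add ((hi x hx).const_mul a) ((hi y hy).const_mul b)]
  have hid : ∀ w ∈ Set.Icc (0 : ℝ) 1,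
      (1 - (a * x + b * y) ^ 2) * (1 + w ^ 2) / (4 * (1 - (a * x + b * y) * w ^ 2))
        - (a * ((1 - x ^ 2) * (1 + w ^ 2) / (4 * (1 - x * w ^ 2)))
          + b * ((1 - y ^ 2) * (1 + w ^ 2) / (4 * (1 - y * w ^ 2))))
      = (1 + w ^ 2) * (a * b * (x - y) ^ 2 * (1 - w ^ 4))
        / (4 * (1 - (a * x + b * y) * w ^ 2) * (1 - x * w ^ 2) * (1 - y * w ^ 2)) := by
    intro w hw
    have h1 := (hpos x hx w hw).ne'
    have h2 := (hpos y hy w hw).ne'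
    have h3 := (hpos _ hm w hw).ne'
    have hb' : b = 1 - a := by linarith
    subst hb'
    field_simp
    ring
  have hsub : x - y ≠ 0 := sub_ne_zero.2 hxy
  refine intervalIntegral.integral_lt_integral_of_continuousOn_of_le_of_exists_lt one_pos
    (((hc x hx).const_smul a).add ((hc y hy).const_smul b)) (hc _ hm) (fun w hw => ?_)
    ⟨0, ⟨le_rfl, zero_le_one⟩, ?_⟩
  · have hw' : w ∈ Set.Icc (0 : ℝ) 1 := ⟨hw.1.le, hw.2⟩
    rw [← sub_nonneg, hid w hw']
    have h1 := hpos x hx w hw'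
    have h2 := hpos y hy w hw'
    have h3 := hpos _ hm w hw'
    have h4 : 0 ≤ 1 - w ^ 4 := sub_nonneg.2 (pow_le_one₀ hw.1.le hw.2)
    positivity
  · rw [← sub_pos, hid 0 ⟨le_rfl, zero_le_one⟩]
    have : 0 < (x - y) ^ 2 := by positivity
    simp
    positivity

theorem gIntegral_eq_param {l : ℝ} (hl : 0 < l) : gIntegral l
    = ∫ w in (0 : ℝ)..1, (1 - ((1 - l) / (1 + l)) ^ 2) * (1 + w ^ 2)
      / (4 * (1 - (1 - l) / (1 + l) * w ^ 2)) := by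
  rw [gIntegral, ← intervalIntegral.integral_const_mul]
  refine intervalIntegral.integral_congr fun w hw => ?_
  rw [Set.uIcc_of_le zero_le_one] at hw
  have h1 := gIntegral_denom_pos hl hw
  have h2 : 1 - (1 - l) / (1 + l) * w ^ 2 = ((1 + l) - (1 - l) * w ^ 2) / (1 + l) := by
    field_simp
  simp only [h2]
  field_simp
  ring

/-- `gFun` is strictly quasiconcave on `(0, ∞)`. -/
theorem min_lt_gFun {a b c : ℝ} (ha : 0 < a) (hab : a < b) (hbc : b < c) :
    min (gFun a) (gFun c) < gFun b := by
  have hb := ha.trans hab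
  have hc := hb.trans hbc
  have hmem : ∀ l : ℝ, 0 < l → (1 - l) / (1 + l) ∈ Set.Ioo (-1 : ℝ) 1 := by
    intro l hl
    constructor
    · rw [lt_div_iff₀ (by linarith)]; linarith
    · rw [div_lt_one (by linarith)]; linarith
  have hanti : ∀ l m : ℝ, 0 < l → l < m → (1 - m) / (1 + m) < (1 - l) / (1 + l) := by
    intro l m hl hlm
    rw [div_lt_div_iff₀ (by linarith) (by linarith)]
    nlinarith
  rw [gFun_eq_gIntegral ha, gFun_eq_gIntegral hb, gFun_eq_gIntegral hc, gIntegral_eq_param ha,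
    gIntegral_eq_param hb, gIntegral_eq_param hc, min_comm]
  -- The change of parameter reverses order but preserves betweenness, so strict concavity in `e`
  -- yields strict quasiconcavity in `l`.
  refine strictConcaveOn_gIntegral_param.lt_on_openSegment (hmem c hc) (hmem a ha)
    (hanti a c ha (hab.trans hbc)).ne ?_
  rw [openSegment_eq_Ioo (hanti a c ha (hab.trans hbc))]
  exact ⟨hanti b c hb hbc, hanti a b ha hab⟩

theorem gFun_sq {μ : ℝ} (hμ : 0 < μ) : gFun (μ ^ 2) = timeMap μ (1 / μ) := by
  rw [gFun_eq_gIntegral (by positivity), timeMap_endpoint hμ]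

theorem continuousOn_gFun : ContinuousOn gFun (Set.Ioi 0) := by
  have h1 : ContinuousOn (fun l : ℝ => (Real.sqrt l, 1 / Real.sqrt l)) (Set.Ioi 0) := by
    refine ContinuousOn.prodMk (by fun_prop) (ContinuousOn.div continuousOn_const (by fun_prop) ?_)
    intro l hl
    exact (Real.sqrt_pos.2 hl).ne'
  refine (continuousOn_timeMap.comp h1 fun l hl => Real.sqrt_pos.2 hl).congr fun l hl => ?_
  have := gFun_sq (Real.sqrt_pos.2 hl)
  rwa [Real.sq_sqrt (le_of_lt hl)] at this

theorem gFun_pos {l : ℝ} (hl : 0 < l) : 0 < gFun l := by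
  have hs := Real.sqrt_pos.2 hl
  have := gFun_sq hs
  rw [Real.sq_sqrt hl.le] at this
  rw [this]
  exact timeMap_pos hs (by positivity) (by field_simp; rfl)

theorem mul_gFun_lt_one {l : ℝ} (hl : 0 < l) : l * gFun l < 1 := by
  have hs := Real.sqrt_pos.2 hl
  have h1 := gFun_sq hs
  have h2 := sq_mul_timeMap_lt_one (ρ := 1 / Real.sqrt l) hs (by positivity) (by field_simp; rfl)
  rw [Real.sq_sqrt hl.le] at h1 h2
  rwa [h1]

theorem exists_gFun_lt_near_zero {ε : ℝ} (hε : 0 < ε) :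
    ∃ δ, 0 < δ ∧ ∀ l, 0 < l → l < δ → gFun l < ε := by
  -- Splitting the logarithm isolates `l log l`, which is continuous at `0`; the whole expression
  -- then takes the value `0` there.
  have hc : ContinuousAt (fun l : ℝ => (l * (Real.log (1 + Real.sqrt (1 - l ^ 2))
      - Real.sqrt (1 - l ^ 2)) - l * Real.log l) / (1 - l ^ 2) ^ (3 / 2 : ℝ)) 0 := by
    refine ContinuousAt.div (ContinuousAt.sub (ContinuousAt.mul continuousAt_id
      (ContinuousAt.sub (ContinuousAt.log (by fun_prop) ?_) (by fun_prop)))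
      Real.continuous_mul_log.continuousAt) (ContinuousAt.rpow_const (by fun_prop) ?_) ?_
    · have : 0 ≤ Real.sqrt (1 - (0 : ℝ) ^ 2) := Real.sqrt_nonneg _
      positivity
    · left; norm_num
    · norm_num
  have hev := hc.eventually_lt_const (show _ < ε by simpa using hε)
  obtain ⟨δ, hδ, h⟩ := Metric.eventually_nhds_iff.1 hev
  refine ⟨min δ 1, by positivity, fun l hl hlt => ?_⟩
  have hl1 : l < 1 := hlt.trans_le (min_le_right _ _)
  have hlδ : dist l 0 < δ := by
    rw [Real.dist_eq, sub_zero, abs_of_pos hl]; exact hlt.trans_le (min_le_left _ _)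
  refine lt_of_eq_of_lt ?_ (h hlδ)
  have : 0 ≤ Real.sqrt (1 - l ^ 2) := Real.sqrt_nonneg _
  rw [gFun, if_pos hl1, Real.log_div (by positivity) hl.ne']
  ring

theorem exists_gFun_lt_near_infty {ε : ℝ} (hε : 0 < ε) :
    ∃ Λ, 0 < Λ ∧ ∀ l, Λ < l → gFun l < ε := by
  refine ⟨1 / ε, by positivity, fun l hl => ?_⟩
  have hl0 : 0 < l := lt_trans (by positivity) hl
  rw [div_lt_iff₀ hε] at hl
  have := mul_gFun_lt_one hl0
  exact lt_of_mul_lt_mul_left (this.trans hl) hl0.le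

theorem exists_isGreatest_gFun : ∃ l, 0 < l ∧ IsGreatest (gFun '' Set.Ioi 0) (gFun l) := by
  obtain ⟨δ, hδ, hδlt⟩ := exists_gFun_lt_near_zero (gFun_pos one_pos)
  obtain ⟨Λ, hΛ, hΛlt⟩ := exists_gFun_lt_near_infty (gFun_pos one_pos)
  have h1δ : δ ≤ 1 := not_lt.1 fun h => lt_irrefl _ (hδlt 1 one_pos h)
  have h1Λ : 1 ≤ Λ := not_lt.1 fun h => lt_irrefl _ (hΛlt 1 h)
  obtain ⟨l, hl, hmax⟩ := isCompact_Icc.exists_isMaxOn (Set.nonempty_Icc.2 (h1δ.trans h1Λ))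
    (continuousOn_gFun.mono fun x (hx : x ∈ Set.Icc δ Λ) => hδ.trans_le hx.1)
  have hl0 : 0 < l := hδ.trans_le hl.1
  have h1 : gFun 1 ≤ gFun l := hmax ⟨h1δ, h1Λ⟩
  refine ⟨l, hl0, ⟨⟨l, hl0, rfl⟩, ?_⟩⟩
  rintro _ ⟨m, hm, rfl⟩
  rcases lt_or_ge m δ with h | h
  · exact (hδlt m hm h).le.trans h1
  · rcases lt_or_ge Λ m with h' | h'
    · exact (hΛlt m h').le.trans h1
    · exact hmax ⟨h, h'⟩

/-- The intermediate value theorem gives one crossing on each side of `l₀`. Quasiconcavity puts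
`gFun` above `L` between them and, compared with `l₀`, at most `L` outside. -/
theorem exists_gFun_levels {L l₀ : ℝ} (hL : 0 < L) (hl₀ : 0 < l₀) (hlt : L < gFun l₀) :
    ∃ l₁ l₂, 0 < l₁ ∧ l₁ < l₂ ∧ gFun l₁ = L ∧ gFun l₂ = L ∧
      (∀ l ∈ Set.Ioo l₁ l₂, L < gFun l) ∧ (∀ l, 0 < l → l ≤ l₁ → gFun l ≤ L) ∧
      ∀ l, l₂ ≤ l → gFun l ≤ L := by
  obtain ⟨δ, hδ, hδlt⟩ := exists_gFun_lt_near_zero hL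
  obtain ⟨Λ, hΛ, hΛlt⟩ := exists_gFun_lt_near_infty hL
  have hδ0 : δ ≤ l₀ := not_lt.1 fun h => lt_asymm hlt (hδlt l₀ hl₀ h)
  have hΛ0 : l₀ ≤ Λ := not_lt.1 fun h => lt_asymm hlt (hΛlt l₀ h)
  obtain ⟨l₁, hl₁, h₁⟩ := intermediate_value_Icc (show δ / 2 ≤ l₀ by linarith)
    (continuousOn_gFun.mono fun x hx => lt_of_lt_of_le (by positivity) hx.1)
    ⟨(hδlt (δ / 2) (by positivity) (by linarith)).le, hlt.le⟩
  obtain ⟨l₂, hl₂, h₂⟩ := intermediate_value_Icc' (show l₀ ≤ Λ + 1 by linarith)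
    (continuousOn_gFun.mono fun x hx => hl₀.trans_le hx.1)
    ⟨(hΛlt (Λ + 1) (by linarith)).le, hlt.le⟩
  have hl₁0 : 0 < l₁ := lt_of_lt_of_le (by positivity) hl₁.1
  have h10 : l₁ < l₀ := lt_of_le_of_ne hl₁.2 fun h => by rw [h] at h₁; linarith
  have h02 : l₀ < l₂ := lt_of_le_of_ne hl₂.1 fun h => by rw [← h] at h₂; linarith
  refine ⟨l₁, l₂, hl₁0, h10.trans h02, h₁, h₂, fun l hl => ?_, fun l hl hle => ?_, fun l hle => ?_⟩
  · have := min_lt_gFun hl₁0 hl.1 hl.2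
    rwa [h₁, h₂, min_self] at this
  · rcases hle.lt_or_eq with h | h
    · have := min_lt_gFun hl h h10
      rw [h₁, min_lt_iff] at this
      rcases this with h' | h' <;> linarith
    · rw [h, h₁]
  · rcases hle.lt_or_eq with h | h
    · have := min_lt_gFun hl₀ h02 h
      rw [h₂, min_lt_iff] at this
      rcases this with h' | h' <;> linarith
    · rw [← h, h₂]

/-! ### Solutions correspond to roots of the time map. -/

/-- Continuing `f` with slope `1` outside `[a, b]` gives an increasing bijection of `ℝ`, so the
inverse is globally continuous and monotone. -/
theorem exists_continuous_inverse {f : ℝ → ℝ} {a b : ℝ} (hab : a ≤ b)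
    (hmono : StrictMonoOn f (Set.Icc a b)) (hf : Continuous f) :
    ∃ S : ℝ → ℝ, Continuous S ∧ StrictMono S ∧ (∀ s ∈ Set.Icc a b, S (f s) = s) ∧
      ∀ x ∈ Set.Icc (f a) (f b), f (S x) = x := by
  have hcl : ∀ x, max a (min x b) ∈ Set.Icc a b := fun x =>
    ⟨le_max_left _ _, max_le hab (min_le_right _ _)⟩
  have hid : ∀ x ∈ Set.Icc a b, max a (min x b) = x := fun x hx => by
    rw [min_eq_left hx.2, max_eq_right hx.1]
  set Y : ℝ → ℝ := fun x => f (max a (min x b)) + (x - max a (min x b)) with hY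
  have hYid : ∀ x ∈ Set.Icc a b, Y x = f x := fun x hx => by simp [hY, hid x hx]
  have hYmono : StrictMono Y := by
    intro x y hxy
    have h1 : max a (min x b) ≤ max a (min y b) := by gcongr
    have h2 : x - max a (min x b) ≤ y - max a (min y b) := by
      simp only [max_def, min_def]; split_ifs <;> linarith
    rcases h1.lt_or_eq with h | h
    · have := hmono (hcl x) (hcl y) h
      simp only [hY]; linarith
    · simp only [hY]; rw [h]; linarith
  have hYcont : Continuous Y := by fun_prop
  have hYsurj : Function.Surjective Y := by
    refine hYcont.surjective ?_ ?_
    · refine Filter.tendsto_atTop_mono (f := fun x => x + (f a - b)) (fun x => ?_)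
        (Filter.tendsto_atTop_add_const_right _ _ Filter.tendsto_id)
      have h1 := hmono.monotoneOn ⟨le_rfl, hab⟩ (hcl x) (hcl x).1
      have h2 := (hcl x).2
      simp only [hY]; linarith
    · refine Filter.tendsto_atBot_mono (f := fun x => x + (f b - a)) (fun x => ?_)
        (Filter.tendsto_atBot_add_const_right _ _ Filter.tendsto_id)
      have h1 := hmono.monotoneOn (hcl x) ⟨hab, le_rfl⟩ (hcl x).2
      have h2 := (hcl x).1
      simp only [hY]; linarith
  set e := hYmono.orderIsoOfSurjective Y hYsurj with he
  have heY : ∀ x, e x = Y x := fun x => rfl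
  have hleft : ∀ s ∈ Set.Icc a b, e.symm (f s) = s := fun s hs => by
    rw [← hYid s hs, ← heY, e.symm_apply_apply]
  refine ⟨e.symm, e.symm.continuous, e.symm.strictMono, hleft, fun x hx => ?_⟩
  have hmem : e.symm x ∈ Set.Icc a b := by
    constructor
    · rw [← hleft a ⟨le_rfl, hab⟩]; exact e.symm.monotone hx.1
    · rw [← hleft b ⟨hab, le_rfl⟩]; exact e.symm.monotone hx.2
  rw [← hYid _ hmem, ← heY, e.apply_symm_apply]

/-- The root set of the time map. -/
def timeMapRoots (μ L : ℝ) : Set ℝ := {ρ | 0 < ρ ∧ μ * ρ ≤ 1 ∧ timeMap μ ρ = L}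

theorem continuous_profileX (μ ρ : ℝ) : Continuous (profileX μ ρ) :=
  continuous_iff_continuousAt.2 fun s => (hasDerivAt_profileX μ ρ s).continuousAt

/-- Invert `profileX` to get `s = S x` and read off the height. With `ξ = μ S` the slope is `-ξ √(2
- ξ²) / (1 - ξ²)` and the flux is `-ξ √(2 - ξ²)`. -/
theorem exists_solution_of_root {μ L ρ : ℝ} (hμ : 0 < μ) (hρ : ρ ∈ timeMapRoots μ L) :
    ∃ u : ℝ → ℝ, IsClassicalSolution (μ ^ 2) L u ∧ (∀ x ∈ Set.Ioo (-L) L, 0 < u x) ∧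
      ∀ s ∈ Set.Icc (-ρ) ρ, u (profileX μ ρ s) = 1 - 1 / (1 + (ρ ^ 2 - s ^ 2)) := by
  obtain ⟨hρ0, hμρ, hL⟩ := hρ
  have hXρ : profileX μ ρ ρ = L := hL
  have hXnρ : profileX μ ρ (-ρ) = -L := by rw [profileX_neg, hXρ]
  have hmono := strictMonoOn_profileX hμ hμρ
  obtain ⟨S, hSc, hSm, hSX, hXS⟩ := exists_continuous_inverse (by linarith) hmono
    (continuous_profileX μ ρ)
  rw [hXρ, hXnρ] at hXS
  have hSL : S L = ρ := by rw [← hXρ]; exact hSX ρ ⟨by linarith, le_rfl⟩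
  have hSnL : S (-L) = -ρ := by rw [← hXnρ]; exact hSX (-ρ) ⟨le_rfl, by linarith⟩
  have hSIoo : ∀ x ∈ Set.Ioo (-L) L, S x ∈ Set.Ioo (-ρ) ρ := fun x hx =>
    ⟨hSnL ▸ hSm hx.1, hSL ▸ hSm hx.2⟩
  have hSsq : ∀ x ∈ Set.Icc (-L) L, 0 ≤ ρ ^ 2 - S x ^ 2 := fun x hx => by
    have h1 : -ρ ≤ S x := hSnL ▸ hSm.monotone hx.1
    have h2 : S x ≤ ρ := hSL ▸ hSm.monotone hx.2
    nlinarith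
  have hSsq' : ∀ x ∈ Set.Ioo (-L) L, 0 < ρ ^ 2 - S x ^ 2 := fun x hx => by
    have := hSIoo x hx
    nlinarith [this.1, this.2]
  have hξ : ∀ x ∈ Set.Ioo (-L) L, (μ * S x) ^ 2 < 1 := fun x hx => by
    have h1 := hSsq' x hx
    have h2 : (μ * ρ) ^ 2 ≤ 1 := by nlinarith [mul_pos hμ hρ0]
    have h3 : 0 < μ ^ 2 := by positivity
    nlinarith
  have hGpos : ∀ x ∈ Set.Ioo (-L) L, 0 < angleWeight (μ * S x) := fun x hx =>
    angleWeight_pos (hξ x hx)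
  have hSd : ∀ x ∈ Set.Ioo (-L) L, HasDerivAt S
      (μ / 2 * ((1 + |ρ ^ 2 - S x ^ 2|) ^ 2 / angleWeight (μ * S x))) x := by
    intro x hx
    have hG := hGpos x hx
    have hne : 2 / μ * (angleWeight (μ * S x) / (1 + |ρ ^ 2 - S x ^ 2|) ^ 2) ≠ 0 := by positivity
    have hev : ∀ᶠ y in nhds x, profileX μ ρ (S y) = y := by
      filter_upwards [Ioo_mem_nhds hx.1 hx.2] with y hy using hXS y ⟨hy.1.le, hy.2.le⟩
    refine (HasDerivAt.of_local_left_inverse hSc.continuousAt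
      (hasDerivAt_profileX μ ρ (S x)) hne hev).congr_deriv ?_
    field_simp
  obtain ⟨u, hu⟩ : ∃ u : ℝ → ℝ, u = fun x => 1 - 1 / (1 + (ρ ^ 2 - S x ^ 2)) := ⟨_, rfl⟩
  have hux : ∀ x, u x = 1 - 1 / (1 + (ρ ^ 2 - S x ^ 2)) := fun x => by rw [hu]
  have hud : ∀ x ∈ Set.Ioo (-L) L, HasDerivAt u
      (-(μ * S x * Real.sqrt (2 - (μ * S x) ^ 2) / (1 - (μ * S x) ^ 2))) x := by
    intro x hx
    have h1 := hSsq' x hx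
    have h2 : 0 < 1 - (μ * S x) ^ 2 := by linarith [hξ x hx]
    have h3 : 0 < Real.sqrt (2 - (μ * S x) ^ 2) := Real.sqrt_pos.2 (by linarith)
    have h4 : 1 + (ρ ^ 2 - S x ^ 2) ≠ 0 := by positivity
    have hd := ((((hSd x hx).pow 2).const_sub (ρ ^ 2)).const_add 1)
    have := ((hasDerivAt_const x (1 : ℝ)).div hd h4).const_sub 1
    rw [hu]
    refine this.congr_deriv ?_
    simp only [Pi.pow_apply]
    rw [abs_of_pos h1, angleWeight_eq (by linarith)]
    field_simp
    ring
  have hderiv : ∀ x ∈ Set.Ioo (-L) L, deriv u x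
      = -(μ * S x * Real.sqrt (2 - (μ * S x) ^ 2) / (1 - (μ * S x) ^ 2)) :=
    fun x hx => (hud x hx).deriv
  have hV : ∀ x ∈ Set.Ioo (-L) L, deriv u x / Real.sqrt (1 + deriv u x ^ 2)
      = -(μ * S x * Real.sqrt (2 - (μ * S x) ^ 2)) := by
    intro x hx
    have h2 : 0 < 1 - (μ * S x) ^ 2 := by linarith [hξ x hx]
    have h3 : Real.sqrt (2 - (μ * S x) ^ 2) ^ 2 = 2 - (μ * S x) ^ 2 :=
      Real.sq_sqrt (by linarith)
    rw [hderiv x hx]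
    generalize μ * S x = ξ at h2 h3 ⊢
    have : 1 + (-(ξ * Real.sqrt (2 - ξ ^ 2) / (1 - ξ ^ 2))) ^ 2 = (1 / (1 - ξ ^ 2)) ^ 2 := by
      rw [neg_sq, div_pow, mul_pow, h3]
      field_simp
      ring
    rw [this, Real.sqrt_sq (by positivity)]
    field_simp
  have hopen : IsOpen (Set.Ioo (-L) L) := isOpen_Ioo
  -- One derivative of `S` is enough, since `u'` is a smooth function of `S` itself.
  have hSC1 : ContDiffOn ℝ 1 S (Set.Ioo (-L) L) := by
    rw [show (1 : WithTop ℕ∞) = 0 + 1 from rfl, contDiffOn_succ_iff_deriv_of_isOpen hopen]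
    refine ⟨fun x hx => (hSd x hx).differentiableAt.differentiableWithinAt, by simp, ?_⟩
    rw [contDiffOn_zero]
    have : ContinuousOn (fun x => μ / 2 * ((1 + |ρ ^ 2 - S x ^ 2|) ^ 2 / angleWeight (μ * S x)))
        (Set.Ioo (-L) L) := by
      refine continuousOn_const.mul (ContinuousOn.div (by fun_prop)
        (continuous_angleWeight.comp (by fun_prop)).continuousOn fun x hx => (hGpos x hx).ne')
    exact this.congr fun x hx => (hSd x hx).deriv
  refine ⟨u, ⟨?_, ?_, ?_, ?_, ?_, ?_⟩, ?_, ?_⟩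
  · rw [show (2 : WithTop ℕ∞) = 1 + 1 by norm_num, contDiffOn_succ_iff_deriv_of_isOpen hopen]
    refine ⟨fun x hx => (hud x hx).differentiableAt.differentiableWithinAt, by simp, ?_⟩
    refine ContDiffOn.congr ?_ hderiv
    have hlin : ContDiffOn ℝ 1 (fun x => μ * S x) (Set.Ioo (-L) L) := contDiffOn_const.mul hSC1
    refine (ContDiffOn.div (hlin.mul (ContDiffOn.sqrt (contDiffOn_const.sub (hlin.pow 2)) ?_))
      (contDiffOn_const.sub (hlin.pow 2)) ?_).neg
    · intro x hx
      have := hξ x hx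
      exact ne_of_gt (by linarith)
    · intro x hx
      exact ne_of_gt (by linarith [hξ x hx])
  · rw [hu]
    refine continuousOn_const.sub (ContinuousOn.div continuousOn_const (by fun_prop) fun x hx => ?_)
    have := hSsq x hx
    positivity
  · intro x hx
    have := hSsq x hx
    rw [hux]
    have : 0 < 1 / (1 + (ρ ^ 2 - S x ^ 2)) := by positivity
    linarith
  · rw [hux, hSnL]; norm_num
  · rw [hux, hSL]; norm_num
  · intro x hx
    have hev : (fun y => deriv u y / Real.sqrt (1 + deriv u y ^ 2))
        =ᶠ[nhds x] fun y => -(μ * S y * Real.sqrt (2 - (μ * S y) ^ 2)) := by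
      filter_upwards [Ioo_mem_nhds hx.1 hx.2] with y hy using hV y hy
    have hd := ((hasDerivAt_mul_sqrt (x := μ * S x) (by linarith [hξ x hx]) (hξ x hx).le).comp x
      ((hSd x hx).const_mul μ)).neg
    have h1 := hSsq' x hx
    have hG := hGpos x hx
    rw [hev.deriv_eq]
    refine (congrArg Neg.neg hd.deriv).trans ?_
    rw [abs_of_pos h1, hux]
    field_simp
    ring
  · intro x hx
    have := hSsq' x hx
    rw [hux, sub_pos, div_lt_one (by linarith)]
    linarith
  · intro s hs
    rw [hux, hSX s hs]

/-- For `v = sin θ` with acute `θ` the function is `-√2 sin (θ / 2)`, which recovers `μ s` from the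
flux. -/
theorem hasDerivAt_angle_variable {v : ℝ} (hv : v ^ 2 < 1) :
    HasDerivAt (fun v : ℝ => -v / Real.sqrt (1 + Real.sqrt (1 - v ^ 2)))
      (-(Real.sqrt (1 + Real.sqrt (1 - v ^ 2)) / (2 * Real.sqrt (1 - v ^ 2)))) v := by
  have hr : 0 < Real.sqrt (1 - v ^ 2) := Real.sqrt_pos.2 (by linarith)
  have hr2 : Real.sqrt (1 - v ^ 2) ^ 2 = 1 - v ^ 2 := Real.sq_sqrt (by linarith)
  have hq : 0 < Real.sqrt (1 + Real.sqrt (1 - v ^ 2)) := Real.sqrt_pos.2 (by linarith)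
  have hq2 : Real.sqrt (1 + Real.sqrt (1 - v ^ 2)) ^ 2 = 1 + Real.sqrt (1 - v ^ 2) :=
    Real.sq_sqrt (by linarith)
  have h1 : HasDerivAt (fun v : ℝ => 1 - v ^ 2) (-(2 * v)) v := by
    simpa using (hasDerivAt_pow 2 v).const_sub 1
  have h2 := ((h1.sqrt (by linarith)).const_add 1).sqrt (by linarith)
  refine ((hasDerivAt_id v).neg.div h2 hq.ne').congr_deriv ?_
  simp only [id, Pi.neg_apply]
  set q := Real.sqrt (1 + Real.sqrt (1 - v ^ 2)) with hqdef
  set r := Real.sqrt (1 - v ^ 2) with hrdef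
  have hrq : r = q ^ 2 - 1 := by linarith
  have hv2 : v ^ 2 = 1 - r ^ 2 := by linarith
  field_simp
  rw [hv2, hrq]
  ring

/-- Positivity is not assumed: the flux decreases strictly, so `u` rises to one critical point and
then falls, hence is positive inside. Consequently the absence of roots excludes all solutions. The
first integral identifies `s`, after which `profileX μ ρ (s x) - x` is constant. -/
theorem exists_root_of_solution {μ L : ℝ} {u : ℝ → ℝ} (hμ : 0 < μ) (hL0 : 0 < L)
    (h : IsClassicalSolution (μ ^ 2) L u) :
    ∃ ρ ∈ timeMapRoots μ L,
      ∀ s ∈ Set.Icc (-ρ) ρ, u (profileX μ ρ s) = 1 - 1 / (1 + (ρ ^ 2 - s ^ 2)) := by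
  have hu1 : ∀ x ∈ Set.Ioo (-L) L, 0 < 1 - u x := fun x hx =>
    sub_pos.2 (h.lt_one x ⟨hx.1.le, hx.2.le⟩)
  obtain ⟨V, hVdef⟩ : ∃ V : ℝ → ℝ, V = fun y => deriv u y / Real.sqrt (1 + deriv u y ^ 2) :=
    ⟨_, rfl⟩
  have hVx : ∀ x, V x = deriv u x / Real.sqrt (1 + deriv u x ^ 2) := fun x => by rw [hVdef]
  have hVd : ∀ x ∈ Set.Ioo (-L) L, HasDerivAt V (-(μ ^ 2 / (1 - u x) ^ 2)) x := by
    intro x hx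
    have heq := h.equation x hx
    rw [← hVdef] at heq
    have hpos : 0 < μ ^ 2 / (1 - u x) ^ 2 := by have := hu1 x hx; positivity
    -- Otherwise `deriv` would take its default value `0`, while the equation makes it nonzero.
    have hd : DifferentiableAt ℝ V x := by
      by_contra hcon
      rw [deriv_zero_of_not_differentiableAt hcon] at heq
      linarith
    exact hd.hasDerivAt.congr_deriv (by linarith)
  have hud : ∀ x ∈ Set.Ioo (-L) L, HasDerivAt u (deriv u x) x := fun x hx =>
    ((h.contDiffOn.differentiableOn (by norm_num)).differentiableAt
      (Ioo_mem_nhds hx.1 hx.2)).hasDerivAt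
  have hVanti : StrictAntiOn V (Set.Ioo (-L) L) := by
    refine strictAntiOn_of_deriv_neg (convex_Ioo _ _)
      (fun x hx => (hVd x hx).continuousAt.continuousWithinAt) fun x hx => ?_
    rw [interior_Ioo] at hx
    rw [(hVd x hx).deriv]
    have := hu1 x hx
    exact neg_neg_of_pos (by positivity)
  obtain ⟨x₀, hx₀, hdx₀⟩ := exists_deriv_eq_zero (show -L < L by linarith) h.continuousOn
    (by rw [h.left_boundary, h.right_boundary])
  have hVx₀ : V x₀ = 0 := by rw [hVx, hdx₀, zero_div]
  have hsign : ∀ x, 0 < V x ↔ 0 < deriv u x := fun x => by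
    have : 0 < Real.sqrt (1 + deriv u x ^ 2) := Real.sqrt_pos.2 (by positivity)
    rw [hVx, div_pos_iff_of_pos_right this]
  have hsign' : ∀ x, V x < 0 ↔ deriv u x < 0 := fun x => by
    have : 0 < Real.sqrt (1 + deriv u x ^ 2) := Real.sqrt_pos.2 (by positivity)
    rw [hVx, div_neg_iff]
    constructor
    · rintro (h | h) <;> linarith [h.1, h.2]
    · exact fun h => Or.inr ⟨h, this⟩
  have hleft : StrictMonoOn u (Set.Icc (-L) x₀) := by
    refine strictMonoOn_of_deriv_pos (convex_Icc _ _)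
      (h.continuousOn.mono (Set.Icc_subset_Icc_right hx₀.2.le)) fun x hx => ?_
    rw [interior_Icc] at hx
    rw [← hsign, ← hVx₀]
    exact hVanti ⟨hx.1, hx.2.trans hx₀.2⟩ hx₀ hx.2
  have hright : StrictAntiOn u (Set.Icc x₀ L) := by
    refine strictAntiOn_of_deriv_neg (convex_Icc _ _)
      (h.continuousOn.mono (Set.Icc_subset_Icc_left hx₀.1.le)) fun x hx => ?_
    rw [interior_Icc] at hx
    rw [← hsign', ← hVx₀]
    exact hVanti hx₀ ⟨hx₀.1.trans hx.1, hx.2⟩ hx.1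
  have hupos : ∀ x ∈ Set.Ioo (-L) L, 0 < u x := by
    intro x hx
    rcases le_total x x₀ with hle | hle
    · rw [← h.left_boundary]
      exact hleft ⟨le_rfl, hx₀.1.le⟩ ⟨hx.1.le, hle⟩ hx.1
    · rw [← h.right_boundary]
      exact hright ⟨hle, hx.2.le⟩ ⟨hx₀.2.le, le_rfl⟩ hx.2
  have hV1 : ∀ x, V x ^ 2 < 1 ∧ Real.sqrt (1 - V x ^ 2) = 1 / Real.sqrt (1 + deriv u x ^ 2) := by
    intro x
    have hp : 0 < 1 + deriv u x ^ 2 := by positivity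
    have : 1 - V x ^ 2 = (1 / Real.sqrt (1 + deriv u x ^ 2)) ^ 2 := by
      rw [hVx, div_pow, div_pow, Real.sq_sqrt hp.le]; field_simp; ring
    constructor
    · have h2 : 0 < (1 / Real.sqrt (1 + deriv u x ^ 2)) ^ 2 := by positivity
      linarith
    · rw [this, Real.sqrt_sq (by positivity)]
  have henergy : ∀ x ∈ Set.Ioo (-L) L,
      Real.sqrt (1 - V x ^ 2) - μ ^ 2 / (1 - u x) = 1 - μ ^ 2 / (1 - u x₀) := by
    have hd : ∀ x ∈ Set.Ioo (-L) L,
        HasDerivAt (fun x => Real.sqrt (1 - V x ^ 2) - μ ^ 2 / (1 - u x)) 0 x := by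
      intro x hx
      have h1 := hu1 x hx
      have h2 := (hV1 x).1
      have h3 := (hV1 x).2
      have h4 : 0 < Real.sqrt (1 + deriv u x ^ 2) := Real.sqrt_pos.2 (by positivity)
      have := ((((hVd x hx).pow 2).const_sub 1).sqrt (by simpa using ne_of_gt (sub_pos.2 h2))).sub
        ((hasDerivAt_const x (μ ^ 2)).div ((hud x hx).const_sub 1) h1.ne')
      refine this.congr_deriv ?_
      simp only [Pi.pow_apply]
      rw [h3, hVx]
      generalize Real.sqrt (1 + deriv u x ^ 2) = q at h4 ⊢
      have hqq : q * q⁻¹ = 1 := mul_inv_cancel₀ h4.ne'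
      field_simp
      ring_nf
      linear_combination (2 * deriv u x * μ ^ 2) * hqq
    intro x hx
    have := isOpen_Ioo.is_const_of_deriv_eq_zero isPreconnected_Ioo
      (fun x hx => (hd x hx).differentiableAt.differentiableWithinAt)
      (fun x hx => (hd x hx).deriv) hx hx₀
    simpa [hVx₀] using this
  have hux₀ := hupos x₀ hx₀
  have h1ux₀ := hu1 x₀ hx₀
  obtain ⟨ρ, hρdef⟩ : ∃ ρ, ρ = Real.sqrt (u x₀ / (1 - u x₀)) := ⟨_, rfl⟩
  have hρ0 : 0 < ρ := by rw [hρdef]; exact Real.sqrt_pos.2 (by positivity)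
  have hρsq : ρ ^ 2 = 1 / (1 - u x₀) - 1 := by
    rw [hρdef, Real.sq_sqrt (by positivity)]; field_simp; ring
  obtain ⟨s, hsdef⟩ : ∃ s : ℝ → ℝ, s = fun x =>
      1 / μ * (-V x / Real.sqrt (1 + Real.sqrt (1 - V x ^ 2))) := ⟨_, rfl⟩
  have hsx : ∀ x, s x = 1 / μ * (-V x / Real.sqrt (1 + Real.sqrt (1 - V x ^ 2))) :=
    fun x => by rw [hsdef]
  have hμssq : ∀ x, (μ * s x) ^ 2 = 1 - Real.sqrt (1 - V x ^ 2) := by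
    intro x
    have h2 := (hV1 x).1
    have hr : 0 ≤ Real.sqrt (1 - V x ^ 2) := Real.sqrt_nonneg _
    have hr2 : Real.sqrt (1 - V x ^ 2) ^ 2 = 1 - V x ^ 2 := Real.sq_sqrt (by linarith)
    have : μ * s x = -V x / Real.sqrt (1 + Real.sqrt (1 - V x ^ 2)) := by
      rw [hsx]; field_simp
    rw [this, div_pow, Real.sq_sqrt (by linarith), div_eq_iff (by positivity)]
    nlinarith
  have hssq : ∀ x ∈ Set.Ioo (-L) L, s x ^ 2 = ρ ^ 2 + 1 - 1 / (1 - u x) := by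
    intro x hx
    have h1 := henergy x hx
    have h2 := hμssq x
    have h3 : μ ^ 2 * (s x ^ 2) = μ ^ 2 * (ρ ^ 2 + 1 - 1 / (1 - u x)) := by
      rw [hρsq, ← mul_pow, h2]
      have e1 : μ ^ 2 / (1 - u x) = μ ^ 2 * (1 / (1 - u x)) := by ring
      have e2 : μ ^ 2 / (1 - u x₀) = μ ^ 2 * (1 / (1 - u x₀)) := by ring
      rw [e1, e2] at h1
      linarith
    exact mul_left_cancel₀ (by positivity) h3
  have hconst : ∀ x ∈ Set.Ioo (-L) L, profileX μ ρ (s x) = x - x₀ := by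
    have hd : ∀ x ∈ Set.Ioo (-L) L, HasDerivAt (fun x => profileX μ ρ (s x) - x) 0 x := by
      intro x hx
      have h1 := hu1 x hx
      have hup := hupos x hx
      have h2 := (hV1 x).1
      have hr : 0 < Real.sqrt (1 - V x ^ 2) := Real.sqrt_pos.2 (by linarith)
      have hq : 0 < Real.sqrt (1 + Real.sqrt (1 - V x ^ 2)) := Real.sqrt_pos.2 (by linarith)
      have hq2 : Real.sqrt (1 + Real.sqrt (1 - V x ^ 2)) ^ 2 = 1 + Real.sqrt (1 - V x ^ 2) :=
        Real.sq_sqrt (by linarith)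
      have hsd : HasDerivAt s (1 / μ * (-(Real.sqrt (1 + Real.sqrt (1 - V x ^ 2))
          / (2 * Real.sqrt (1 - V x ^ 2))) * -(μ ^ 2 / (1 - u x) ^ 2))) x := by
        rw [hsdef]
        exact ((hasDerivAt_angle_variable h2).comp x (hVd x hx)).const_mul (1 / μ)
      have hG : angleWeight (μ * s x) = Real.sqrt (1 - V x ^ 2)
          / Real.sqrt (1 + Real.sqrt (1 - V x ^ 2)) := by
        rw [angleWeight_eq (by rw [hμssq x]; linarith), hμssq x]
        congr 1
        · ring
        · congr 1; ring
      have hW : 1 + |ρ ^ 2 - s x ^ 2| = 1 / (1 - u x) := by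
        have h5 : 1 ≤ 1 / (1 - u x) := by rw [le_div_iff₀ h1]; linarith
        rw [hssq x hx, abs_of_nonneg (by linarith)]; ring
      refine (((hasDerivAt_profileX μ ρ (s x)).comp x hsd).sub (hasDerivAt_id x)).congr_deriv ?_
      rw [hG, hW]
      field_simp
      ring
    intro x hx
    have := isOpen_Ioo.is_const_of_deriv_eq_zero isPreconnected_Ioo
      (fun x hx => (hd x hx).differentiableAt.differentiableWithinAt)
      (fun x hx => (hd x hx).deriv) hx hx₀
    have hs0 : s x₀ = 0 := by rw [hsx, hVx₀]; simp
    have hX0 : profileX μ ρ 0 = 0 := by simp [profileX]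
    simp only [hs0, hX0] at this
    linarith
  -- `w` is `s²` written through `u` alone. It is continuous up to `±L`, where `u'` need not exist,
  -- so identities for `s` pass to the endpoints as identities for `±√w`.
  obtain ⟨w, hwdef⟩ : ∃ w : ℝ → ℝ, w = fun x => ρ ^ 2 + 1 - 1 / (1 - u x) := ⟨_, rfl⟩
  have hwx : ∀ x, w x = ρ ^ 2 + 1 - 1 / (1 - u x) := fun x => by rw [hwdef]
  have hwc : ContinuousOn w (Set.Icc (-L) L) := by
    rw [hwdef]
    exact continuousOn_const.sub (continuousOn_const.div (continuousOn_const.sub h.continuousOn)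
      fun x hx => (sub_pos.2 (h.lt_one x hx)).ne')
  have hwL : w L = ρ ^ 2 := by rw [hwx, h.right_boundary]; norm_num
  have hwnL : w (-L) = ρ ^ 2 := by rw [hwx, h.left_boundary]; norm_num
  have hsqrtρ : Real.sqrt (ρ ^ 2) = ρ := Real.sqrt_sq hρ0.le
  have hcl : Set.Icc (-L) L ⊆ closure (Set.Ioo (-L) L) := by
    rw [closure_Ioo (by linarith : -L ≠ L)]
  have hsR : ∀ x ∈ Set.Ioo (-L) L, x₀ ≤ x → s x = Real.sqrt (w x) := by
    intro x hx hle
    have hV : V x ≤ 0 := hVx₀ ▸ hVanti.antitoneOn hx₀ hx hle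
    have hs : 0 ≤ s x := by
      rw [hsx]
      exact mul_nonneg (by positivity) (div_nonneg (by linarith) (Real.sqrt_nonneg _))
    rw [hwx, ← hssq x hx, Real.sqrt_sq hs]
  have hsL : ∀ x ∈ Set.Ioo (-L) L, x ≤ x₀ → s x = -Real.sqrt (w x) := by
    intro x hx hle
    have hV : 0 ≤ V x := hVx₀ ▸ hVanti.antitoneOn hx hx₀ hle
    have hs : 0 ≤ -s x := by
      rw [hsx, ← mul_neg, ← neg_div, neg_neg]
      exact mul_nonneg (by positivity) (div_nonneg hV (Real.sqrt_nonneg _))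
    rw [hwx, ← hssq x hx, ← neg_sq, Real.sqrt_sq hs, neg_neg]
  have hXR : ∀ x ∈ Set.Icc x₀ L, profileX μ ρ (Real.sqrt (w x)) = x - x₀ := by
    have : Set.EqOn (fun x => profileX μ ρ (Real.sqrt (w x))) (fun x => x - x₀) (Set.Ico x₀ L) := by
      intro x hx
      have hx' : x ∈ Set.Ioo (-L) L := ⟨hx₀.1.trans_le hx.1, hx.2⟩
      simp only
      rw [← hsR x hx' hx.1, hconst x hx']
    refine this.of_subset_closure ((continuous_profileX μ ρ).comp_continuousOn
      (hwc.mono (Set.Icc_subset_Icc_left hx₀.1.le)).sqrt) (by fun_prop) Set.Ico_subset_Icc_self ?_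
    rw [closure_Ico hx₀.2.ne]
  have hXL : ∀ x ∈ Set.Icc (-L) x₀, profileX μ ρ (-Real.sqrt (w x)) = x - x₀ := by
    have : Set.EqOn (fun x => profileX μ ρ (-Real.sqrt (w x))) (fun x => x - x₀)
        (Set.Ioc (-L) x₀) := by
      intro x hx
      have hx' : x ∈ Set.Ioo (-L) L := ⟨hx.1, hx.2.trans_lt hx₀.2⟩
      simp only
      rw [← hsL x hx' hx.2, hconst x hx']
    refine this.of_subset_closure ((continuous_profileX μ ρ).comp_continuousOn
      (hwc.mono (Set.Icc_subset_Icc_right hx₀.2.le)).sqrt.neg) (by fun_prop)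
      Set.Ioc_subset_Icc_self ?_
    rw [closure_Ioc hx₀.1.ne]
  have hend := hXR L ⟨hx₀.2.le, le_rfl⟩
  have hend' := hXL (-L) ⟨le_rfl, hx₀.1.le⟩
  rw [hwL, hsqrtρ] at hend
  rw [hwnL, hsqrtρ, profileX_neg] at hend'
  -- Since `profileX` is odd, the endpoint identities say that the critical point is equally far
  -- from `-L` and `L`.
  have hx₀0 : x₀ = 0 := by linarith
  have hXρ : profileX μ ρ ρ = L := by linarith
  have hwμ : ∀ x ∈ Set.Ioo (-L) L, w x ≤ (1 / μ) ^ 2 := by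
    intro x hx
    have h1 := hμssq x
    have h2 : 0 ≤ Real.sqrt (1 - V x ^ 2) := Real.sqrt_nonneg _
    rw [hwx, ← hssq x hx, one_div, inv_pow, ← one_div, le_div_iff₀ (by positivity)]
    rw [mul_pow] at h1
    linarith
  -- `(μ s)² = 1 - cos θ ≤ 1` inside, and the bound survives in the limit at `L`; equality is the
  -- case of vertical slope.
  have hρμ : μ * ρ ≤ 1 := by
    have hle : w L ≤ (1 / μ) ^ 2 :=
      ContinuousWithinAt.closure_le (hcl ⟨by linarith, le_rfl⟩)
        ((hwc L ⟨by linarith, le_rfl⟩).mono Set.Ioo_subset_Icc_self)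
        continuousWithinAt_const hwμ
    rw [hwL] at hle
    have := (pow_le_pow_iff_left₀ hρ0.le (by positivity) two_ne_zero).1 hle
    rwa [le_div_iff₀ hμ, mul_comm] at this
  refine ⟨ρ, ⟨hρ0, hρμ, hXρ⟩, ?_⟩
  have hmono := strictMonoOn_profileX hμ hρμ
  have hX0 : profileX μ ρ 0 = 0 := by simp [profileX]
  have hunn : ∀ x ∈ Set.Icc (-L) L, 0 ≤ u x := by
    intro x hx
    rcases le_total x x₀ with hle | hle
    · rw [← h.left_boundary]
      exact hleft.monotoneOn ⟨le_rfl, hx₀.1.le⟩ ⟨hx.1, hle⟩ hx.1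
    · rw [← h.right_boundary]
      exact hright.antitoneOn ⟨hle, hx.2⟩ ⟨hx₀.2.le, le_rfl⟩ hx.2
  have hwρ : ∀ x ∈ Set.Icc (-L) L, Real.sqrt (w x) ≤ ρ := by
    intro x hx
    have h1 : 0 < 1 - u x := sub_pos.2 (h.lt_one x hx)
    have h5 : 1 ≤ 1 / (1 - u x) := by rw [le_div_iff₀ h1]; linarith [hunn x hx]
    rw [← hsqrtρ]
    exact Real.sqrt_le_sqrt (by rw [hwx]; linarith)
  have hwnn : ∀ x ∈ Set.Icc (-L) L, 0 ≤ w x := by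
    intro x hx
    refine ContinuousWithinAt.closure_le (hcl hx) continuousWithinAt_const
      ((hwc x hx).mono Set.Ioo_subset_Icc_self) fun y hy => ?_
    rw [hwx, ← hssq y hy]; positivity
  intro t ht
  obtain ⟨x, hxdef⟩ : ∃ x, x = profileX μ ρ t := ⟨_, rfl⟩
  have hx : x ∈ Set.Icc (-L) L := by
    have h1 := hmono.monotoneOn ⟨le_rfl, by linarith⟩ ht ht.1
    have h2 := hmono.monotoneOn ht ⟨by linarith, le_rfl⟩ ht.2
    rw [profileX_neg, hXρ] at h1
    rw [hXρ] at h2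
    rw [hxdef]; exact ⟨h1, h2⟩
  have ht2 : t ^ 2 = w x := by
    have hw0 := Real.sqrt_nonneg (w x)
    have hwr := hwρ x hx
    rcases le_total x₀ x with hle | hle
    · have h1 := hXR x ⟨hle, hx.2⟩
      rw [hx₀0, sub_zero] at h1
      have := hmono.injOn ⟨by linarith, hwr⟩ ht (h1.trans hxdef)
      rw [← this, Real.sq_sqrt (hwnn x hx)]
    · have h1 := hXL x ⟨hx.1, hle⟩
      rw [hx₀0, sub_zero] at h1
      have := hmono.injOn ⟨by linarith, by linarith⟩ ht (h1.trans hxdef)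
      rw [← this, neg_sq, Real.sq_sqrt (hwnn x hx)]
  have h1 : 0 < 1 - u x := sub_pos.2 (h.lt_one x hx)
  rw [← hxdef, ht2, hwx, show 1 + (ρ ^ 2 - (ρ ^ 2 + 1 - 1 / (1 - u x))) = 1 / (1 - u x) by ring,
    one_div_one_div]
  ring

theorem mem_range_profileX {μ L ρ : ℝ} (hρ : ρ ∈ timeMapRoots μ L) {x : ℝ}
    (hx : x ∈ Set.Icc (-L) L) : ∃ s ∈ Set.Icc (-ρ) ρ, profileX μ ρ s = x := by
  have hL : profileX μ ρ ρ = L := hρ.2.2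
  have hρ0 := hρ.1
  refine intermediate_value_Icc (by linarith) (continuous_profileX μ ρ).continuousOn ?_
  rwa [profileX_neg, hL]

/-- Equal profiles force equal solutions on `[-L, L]`, and distinct roots are told apart by the
height at `0`. -/
theorem encard_positiveSolutions {μ L : ℝ} (hμ : 0 < μ) (hL : 0 < L) :
    (positiveSolutions (μ ^ 2) L).encard = (timeMapRoots μ L).encard := by
  choose! U hU using fun ρ (hρ : ρ ∈ timeMapRoots μ L) => exists_solution_of_root hμ hρ
  have himage : positiveSolutions (μ ^ 2) L
      = (fun ρ (x : Set.Icc (-L) L) => U ρ x) '' timeMapRoots μ L := by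
    ext v
    constructor
    · rintro ⟨u, ⟨hu, -⟩, rfl⟩
      obtain ⟨ρ, hρ, hprof⟩ := exists_root_of_solution hμ hL hu
      refine ⟨ρ, hρ, funext fun x => ?_⟩
      obtain ⟨s, hs, hsx⟩ := mem_range_profileX hρ x.2
      simp only
      rw [← hsx, hprof s hs, (hU ρ hρ).2.2 s hs]
    · rintro ⟨ρ, hρ, rfl⟩
      exact ⟨U ρ, ⟨(hU ρ hρ).1, (hU ρ hρ).2.1⟩, rfl⟩
  rw [himage]
  refine Set.InjOn.encard_image fun ρ₁ h1 ρ₂ h2 heq => ?_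
  have hval : ∀ ρ ∈ timeMapRoots μ L, U ρ 0 = 1 - 1 / (1 + ρ ^ 2) := by
    intro ρ hρ
    have h0 : profileX μ ρ 0 = 0 := by simp [profileX]
    have := (hU ρ hρ).2.2 0 ⟨by linarith [hρ.1], hρ.1.le⟩
    rw [h0] at this
    rw [this]; norm_num
  have := congrFun heq ⟨0, by linarith, hL.le⟩
  simp only [hval ρ₁ h1, hval ρ₂ h2] at this
  have h3 : 1 / (1 + ρ₁ ^ 2) = 1 / (1 + ρ₂ ^ 2) := by linarith
  rw [div_eq_div_iff (by positivity) (by positivity)] at h3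
  exact (pow_left_inj₀ h1.1.le h2.1.le two_ne_zero).1 (by linarith)

/-! ### Counting the preimages of a level under a single-peaked function. -/

section Unimodal

variable {n : ℝ → ℝ} {r P L : ℝ}

theorem encard_unimodal_peak (hr : 0 < r) (hrP : r < P) (hmono : StrictMonoOn n (Set.Icc 0 r))
    (hanti : StrictAntiOn n (Set.Icc r P)) (hpeak : n r = L) :
    {ρ | 0 < ρ ∧ ρ ≤ P ∧ n ρ = L}.encard = 1 := by
  rw [Set.encard_eq_one]
  refine ⟨r, Set.ext fun ρ => ⟨fun h => ?_, fun h => ?_⟩⟩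
  · rcases le_total ρ r with h' | h'
    · exact hmono.injOn ⟨h.1.le, h'⟩ ⟨hr.le, le_rfl⟩ (h.2.2.trans hpeak.symm)
    · exact hanti.injOn ⟨h', h.2.1⟩ ⟨le_rfl, hrP.le⟩ (h.2.2.trans hpeak.symm)
  · rw [Set.mem_singleton_iff.1 h]
    exact ⟨hr, hrP.le, hpeak⟩

theorem exists_unimodal_ascending_root (hn : Continuous n) (h0 : n 0 = 0) (hL : 0 < L) (hr : 0 < r)
    (hpeak : L < n r) : ∃ a, 0 < a ∧ a < r ∧ n a = L := by
  obtain ⟨a, ha, hna⟩ := intermediate_value_Icc hr.le hn.continuousOn ⟨h0.trans_le hL.le, hpeak.le⟩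
  refine ⟨a, lt_of_le_of_ne ha.1 fun h => ?_, lt_of_le_of_ne ha.2 fun h => ?_, hna⟩
  · rw [← h, h0] at hna; exact hL.ne hna
  · rw [h] at hna; exact hpeak.ne' hna

theorem encard_unimodal_of_lt_end (hn : Continuous n) (h0 : n 0 = 0) (hL : 0 < L) (hr : 0 < r)
    (hrP : r < P) (hmono : StrictMonoOn n (Set.Icc 0 r)) (hanti : StrictAntiOn n (Set.Icc r P))
    (hend : L < n P) : {ρ | 0 < ρ ∧ ρ ≤ P ∧ n ρ = L}.encard = 1 := by
  have hpeak : n P < n r := hanti ⟨le_rfl, hrP.le⟩ ⟨hrP.le, le_rfl⟩ hrP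
  obtain ⟨a, ha0, har, hna⟩ := exists_unimodal_ascending_root hn h0 hL hr (hend.trans hpeak)
  rw [Set.encard_eq_one]
  refine ⟨a, Set.ext fun ρ => ⟨fun h => ?_, fun h => ?_⟩⟩
  · rcases le_total ρ r with h' | h'
    · exact hmono.injOn ⟨h.1.le, h'⟩ ⟨ha0.le, har.le⟩ (h.2.2.trans hna.symm)
    · have := hanti.antitoneOn ⟨h', h.2.1⟩ ⟨hrP.le, le_rfl⟩ h.2.1
      rw [h.2.2] at this
      exact absurd hend (not_lt.2 this)
  · rw [Set.mem_singleton_iff.1 h]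
    exact ⟨ha0, (har.trans hrP).le, hna⟩

theorem encard_unimodal_of_end_le (hn : Continuous n) (h0 : n 0 = 0) (hL : 0 < L) (hr : 0 < r)
    (hrP : r < P) (hmono : StrictMonoOn n (Set.Icc 0 r)) (hanti : StrictAntiOn n (Set.Icc r P))
    (hend : n P ≤ L) (hpeak : L < n r) : {ρ | 0 < ρ ∧ ρ ≤ P ∧ n ρ = L}.encard = 2 := by
  obtain ⟨a, ha0, har, hna⟩ := exists_unimodal_ascending_root hn h0 hL hr hpeak
  obtain ⟨b, hb, hnb⟩ := intermediate_value_Icc' hrP.le hn.continuousOn ⟨hend, hpeak.le⟩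
  have hrb : r < b := lt_of_le_of_ne hb.1 fun h => by rw [← h] at hnb; exact hpeak.ne' hnb
  rw [← Set.encard_pair (har.trans hrb).ne]
  congr 1
  refine Set.ext fun ρ => ⟨fun h => ?_, fun h => ?_⟩
  · rcases le_total ρ r with h' | h'
    · exact Or.inl (hmono.injOn ⟨h.1.le, h'⟩ ⟨ha0.le, har.le⟩ (h.2.2.trans hna.symm))
    · exact Or.inr (hanti.injOn ⟨h', h.2.1⟩ hb (h.2.2.trans hnb.symm))
  · rcases h with rfl | rfl
    · exact ⟨ha0, (har.trans hrP).le, hna⟩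
    · exact ⟨hr.trans hrb, hb.2, hnb⟩

end Unimodal

theorem timeMapRoots_eq {μ : ℝ} (hμ : 0 < μ) (L : ℝ) :
    timeMapRoots μ L = {ρ | 0 < ρ ∧ ρ ≤ 1 / μ ∧ timeMap μ ρ = L} := by
  ext ρ
  simp only [timeMapRoots, Set.mem_ofPred_eq, le_div_iff₀ hμ, mul_comm]

/-! ### Assembly of the multiplicity statement. -/

/-- The multiplicity of positive solutions, in terms of the critical parameter and of `gFun`. -/
theorem exists_critical_multiplicity {L : ℝ} (hL : 0 < L) :
    ∃ lamStar, 0 < lamStar ∧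
      (∀ lam, 0 < lam → lam < lamStar → gFun lam ≤ L → (positiveSolutions lam L).encard = 2) ∧
      (∀ lam, 0 < lam → L < gFun lam → (positiveSolutions lam L).encard = 1) ∧
      (positiveSolutions lamStar L).encard = 1 ∧
      (∀ lam, lamStar < lam → ¬∃ u : ℝ → ℝ, IsClassicalSolution lam L u) ∧
      (∀ lam, 0 < lam → L ≤ gFun lam → lam < lamStar) ∧
      lamStar < min L⁻¹ (Real.pi ^ 2 / (27 * L ^ 2)) := by
  obtain ⟨μs, hμs, ⟨rs, hrs, hμrs, hTrs⟩, hmax⟩ := exists_critical_parameter hL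
  have hgend : ∀ lam, 0 < lam → timeMap (Real.sqrt lam) (1 / Real.sqrt lam) = gFun lam :=
    fun lam hlam => by rw [← gFun_sq (Real.sqrt_pos.2 hlam), Real.sq_sqrt hlam.le]
  have hcount : ∀ lam, 0 < lam → (positiveSolutions lam L).encard
      = {ρ | 0 < ρ ∧ ρ ≤ 1 / Real.sqrt lam ∧ timeMap (Real.sqrt lam) ρ = L}.encard :=
    fun lam hlam => by
      rw [← timeMapRoots_eq (Real.sqrt_pos.2 hlam),
        ← encard_positiveSolutions (Real.sqrt_pos.2 hlam) hL, Real.sq_sqrt hlam.le]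
  have hle : ∀ μ ρ, μs ≤ μ → 0 < ρ → μ * ρ ≤ 1 → timeMap μ ρ ≤ L := by
    intro μ ρ h hρ hμρ
    have h1 := hmax ρ hρ ((mul_le_mul_of_nonneg_right h hρ.le).trans hμρ)
    rcases h.lt_or_eq with h' | h'
    · exact (timeMap_strictAnti_left hμs h' hρ hμρ).le.trans h1
    · rwa [← h']
  refine ⟨μs ^ 2, by positivity, ?_, ?_, ?_, ?_, ?_, ?_⟩
  · intro lam hlam hlt hg
    have hμ := Real.sqrt_pos.2 hlam
    have hμlt : Real.sqrt lam < μs := (Real.sqrt_lt' hμs).2 hlt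
    obtain ⟨r, hr, -, hrP, hmono, hanti⟩ := exists_timeMap_peak hμ
    rw [hcount lam hlam]
    refine encard_unimodal_of_end_le (continuous_timeMap_right _) (timeMap_zero _) hL hr hrP hmono
      hanti (by rwa [hgend lam hlam]) ?_
    -- The critical `rs` stays admissible for the smaller `μ`, where its time-map value, and hence
    -- the peak, exceeds `L`.
    have h1 := timeMap_strictAnti_left hμ hμlt hrs hμrs
    rw [hTrs] at h1
    refine h1.trans_le ?_
    rcases le_total rs r with h | h
    · exact hmono.monotoneOn ⟨hrs.le, h⟩ ⟨hr.le, le_rfl⟩ h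
    · refine hanti.antitoneOn ⟨le_rfl, hrP.le⟩ ⟨h, ?_⟩ h
      rw [le_div_iff₀ hμ, mul_comm]
      exact (mul_le_mul_of_nonneg_right hμlt.le hrs.le).trans hμrs
  · intro lam hlam hg
    obtain ⟨r, hr, -, hrP, hmono, hanti⟩ := exists_timeMap_peak (Real.sqrt_pos.2 hlam)
    rw [hcount lam hlam]
    exact encard_unimodal_of_lt_end (continuous_timeMap_right _) (timeMap_zero _) hL hr hrP hmono
      hanti (by rwa [hgend lam hlam])
  · obtain ⟨r, hr, -, hrP, hmono, hanti⟩ := exists_timeMap_peak hμs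
    rw [hcount _ (by positivity), Real.sqrt_sq hμs.le]
    refine encard_unimodal_peak hr hrP hmono hanti (le_antisymm ?_ ?_)
    · refine hmax r hr ?_
      rw [lt_div_iff₀ hμs, mul_comm] at hrP
      exact hrP.le
    · rw [← hTrs]
      rcases le_total rs r with h | h
      · exact hmono.monotoneOn ⟨hrs.le, h⟩ ⟨hr.le, le_rfl⟩ h
      · refine hanti.antitoneOn ⟨le_rfl, hrP.le⟩ ⟨h, ?_⟩ h
        rwa [le_div_iff₀ hμs, mul_comm]
  · rintro lam hlt ⟨u, hu⟩
    have hlam : 0 < lam := lt_trans (by positivity) hlt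
    have hμlt : μs < Real.sqrt lam := Real.lt_sqrt_of_sq_lt hlt
    rw [← Real.sq_sqrt hlam.le] at hu
    obtain ⟨ρ, ⟨hρ, hμρ, hT⟩, -⟩ := exists_root_of_solution (hμs.trans hμlt) hL hu
    have h1 := timeMap_strictAnti_left hμs hμlt hρ hμρ
    rw [hT] at h1
    exact absurd h1 (not_lt.2
      (hmax ρ hρ ((mul_le_mul_of_nonneg_right hμlt.le hρ.le).trans hμρ)))
  -- The endpoint value is strictly below the peak, so `L ≤ gFun lam` puts the peak above `L`, which
  -- is impossible from the critical parameter on.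
  · intro lam hlam hg
    have hμ := Real.sqrt_pos.2 hlam
    obtain ⟨r, hr, -, hrP, hmono, hanti⟩ := exists_timeMap_peak hμ
    have hpeak := hanti ⟨le_rfl, hrP.le⟩ ⟨hrP.le, le_rfl⟩ hrP
    rw [hgend lam hlam] at hpeak
    by_contra hcon
    have hμle : μs ≤ Real.sqrt lam := Real.le_sqrt_of_sq_le (not_lt.1 hcon)
    rw [lt_div_iff₀ hμ, mul_comm] at hrP
    have := hle _ r hμle hr hrP.le
    linarith
  · have h1 := sq_mul_timeMap_lt_one hμs hrs hμrs
    have h2 := sq_mul_timeMap_sq_lt hμs hrs hμrs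
    rw [hTrs] at h1 h2
    rw [lt_min_iff]
    constructor
    · rwa [← one_div, lt_div_iff₀ hL]
    · rw [lt_div_iff₀ (by positivity)]
      linarith

theorem theorem1p1 :
    ∃ Lstar : ℝ, IsGreatest (gFun '' Set.Ioi 0) Lstar ∧
      ∀ L : ℝ, 0 < L →
        (L < Lstar →
          ∃ lam₁ lam₂ lamStar : ℝ, 0 < lam₁ ∧ lam₁ < lam₂ ∧ lam₂ < lamStar ∧
            (∀ lam ∈ Set.Ioc 0 lam₁ ∪ Set.Ico lam₂ lamStar,
              (positiveSolutions lam L).encard = 2) ∧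
            (∀ lam ∈ Set.Ioo lam₁ lam₂ ∪ {lamStar},
              (positiveSolutions lam L).encard = 1) ∧
            (∀ lam : ℝ, lamStar < lam → ¬ ∃ u : ℝ → ℝ, IsClassicalSolution lam L u) ∧
            lamStar < min L⁻¹ (Real.pi ^ 2 / (27 * L ^ 2))) ∧
        (Lstar ≤ L →
          ∃ lamStar : ℝ, 0 < lamStar ∧
            (∀ lam ∈ Set.Ioo 0 lamStar, (positiveSolutions lam L).encard = 2) ∧
            (positiveSolutions lamStar L).encard = 1 ∧
            (∀ lam : ℝ, lamStar < lam → ¬ ∃ u : ℝ → ℝ, IsClassicalSolution lam L u) ∧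
            lamStar < min L⁻¹ (Real.pi ^ 2 / (27 * L ^ 2))) := by
  obtain ⟨l₀, hl₀, hgreatest⟩ := exists_isGreatest_gFun
  refine ⟨gFun l₀, hgreatest, fun L hL => ?_⟩
  obtain ⟨ls, hls, htwo, hone, hcrit, hnone, hbelow, hbound⟩ := exists_critical_multiplicity hL
  refine ⟨fun hlt => ?_, fun hge => ?_⟩
  · obtain ⟨l₁, l₂, hl₁, h12, hg₁, hg₂, hmid, hlow, hhigh⟩ := exists_gFun_levels hL hl₀ hlt
    -- At `l₂` the endpoint value is exactly `L`, so `l₂` lies strictly below the critical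
    -- parameter.
    have hl₂ := hbelow l₂ (hl₁.trans h12) hg₂.ge
    refine ⟨l₁, l₂, ls, hl₁, h12, hl₂, ?_, ?_, hnone, hbound⟩
    · rintro lam (h | h)
      · exact htwo lam h.1 (h.2.trans_lt (h12.trans hl₂)) (hlow lam h.1 h.2)
      · exact htwo lam ((hl₁.trans h12).trans_le h.1) h.2 (hhigh lam h.1)
    · rintro lam (h | h)
      · exact hone lam (hl₁.trans h.1) (hmid lam h)
      · rw [Set.mem_singleton_iff.1 h]; exact hcrit
  · exact ⟨ls, hls, fun lam h => htwo lam h.1 h.2 ((hgreatest.2 ⟨lam, h.1, rfl⟩).trans hge),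
      hcrit, hnone, hbound⟩
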